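/- Let $q:\mathbb R\to\mathbb R$ be locally integrable and even ($q(-x)=q(x)$ for all $x$), and suppose that $\tau_q(y)=-y''-qy$ is in the limit circle case at $+\infty$ and at $-\infty$, i.e. for every $\lambda\in\mathbb C$ every solution of $\tau_q(y)=\lambda y$ lies in $L^2((a,\infty))$ and in $L^2((-\infty,a))$ for some $a\in\mathbb R$. Let $$\mathcal D_{\max}=\{y\in L^2(\mathbb R): y,y'\in AC_{loc}(\mathbb R),\ \tau_q(y)\in L^2(\mathbb R)\}$$ and let $A_{\max}y=\tau_q(y)$ for $y\in\mathcal D_{\max}$. Put $[f,g]_x=\overline{f(x)}g'(x)-\overline{f'(x)}g(x)$ and $[f,g]_{\pm\infty}=\lim_{x\to\pm\infty}[f,g]_x$. Let $w_1,w_2$ be real-valued solutions of $\tau_q(y)=0$ with $w_1$ odd, $w_2$ even and $[w_1,w_2]_{-\infty}=[w_1,w_2]_{\infty}=1$, and for $f\in\mathcal D_{\max}$ and $j=1,2$ set $\alpha_j(f)=[w_j,f]_{-\infty}$ and $\beta_j(f)=[w_j,f]_{\infty}$. Let $(\mathcal Pf)(x)=f(-x)$ on $L^2(\mathbb R)$.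 A closed densely defined operator $H$ in $L^2(\mathbb R)$ is called $\mathcal P$-self-adjoint if $\operatorname{dom}H=\{f:\mathcal Pf\in\operatorname{dom}H^*\}$ and $Hf=\mathcal PH^*\mathcal Pf$ for all $f\in\operatorname{dom}H$. Below, $\widetilde A$ is the restriction of $A_{\max}$ to the indicated domain. 1. (Separated conditions.) Let $\xi,\eta\in\mathbb C$ with $|\xi|=|\eta|=1$, let $\alpha,\beta\in[0,2\pi)$, and let $\operatorname{dom}\widetilde A$ be the set of all $f\in\mathcal D_{\max}$ with $$\alpha_1(f)\,\xi\cos\alpha-\alpha_2(f)\sin\alpha=0,\qquad \beta_1(f)\,\eta\cos\beta-\beta_2(f)\sin\beta=0.$$ (i) If $\alpha\in\{0,\pi/2,\pi,3\pi/2\}$ or $\beta\in\{0,\pi/2,\pi,3\pi/2\}$, then $\widetilde A$ is $\mathcal P$-self-adjoint if and only if $\alpha+\beta\equiv0\pmod\pi$. (ii) If $\alpha,\beta\notin\{0,\pi/2,\pi,3\pi/2\}$, then $\widetilde A$ is $\mathcal P$-self-adjoint if and only if either $\alpha+\beta\equiv0\pmod\pi$ and $\xi\eta=1$, or $|\alpha-\beta|\equiv0\pmod\pi$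 and $\xi\eta=-1$. 2. (Mixed conditions.) Let $a,b,c,d\in\mathbb C$ and let $\operatorname{dom}\widetilde A$ be either the set of all $f\in\mathcal D_{\max}$ with $$\begin{pmatrix}\alpha_1(f)\\ \alpha_2(f)\end{pmatrix}=\begin{pmatrix}a&b\\c&d\end{pmatrix}\begin{pmatrix}\beta_1(f)\\ \beta_2(f)\end{pmatrix},$$ or the set of all $f\in\mathcal D_{\max}$ with $$\begin{pmatrix}\beta_1(f)\\ \beta_2(f)\end{pmatrix}=\begin{pmatrix}a&b\\c&d\end{pmatrix}\begin{pmatrix}\alpha_1(f)\\ \alpha_2(f)\end{pmatrix}.$$ In both cases $\widetilde A$ is $\mathcal P$-self-adjoint if and only if $d=\overline a$ and $b,c\in\mathbb R$. -/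

import Mathlib

open MeasureTheory Filter Topology

noncomputable section

namespace PTSL

/-! ### The differential expression and its solutions -/

/-- Local absolute continuity: absolute continuity on every compact interval. -/
def ACLoc (f : ℝ → ℂ) : Prop :=
  ∀ a b : ℝ, AbsolutelyContinuousOnInterval f a b

/-- The differential expression `τ_q y = - y'' - q y`. -/
def tau (q : ℝ → ℝ) (y : ℝ → ℂ) (x : ℝ) : ℂ :=
  -deriv (deriv y) x - (q x : ℂ) * y x

/-- `y` and `y'` are locally absolutely continuous (so that `y` is continuously differentiable
and `y''` exists almost everywhere). -/
structure IsRegular (y : ℝ → ℂ) : Prop where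
  differentiable : Differentiable ℝ y
  acLoc : ACLoc y
  acLoc_deriv : ACLoc (deriv y)

/-- `y` solves `τ_q y = z y` (almost everywhere, in the Carathéodory sense). -/
def IsSolution (q : ℝ → ℝ) (z : ℂ) (y : ℝ → ℂ) : Prop :=
  IsRegular y ∧ ∀ᵐ x : ℝ, tau q y x = z * y x

/-- `τ_q` is in the limit circle case at `+∞`. -/
def LimitCircleAtTop (q : ℝ → ℝ) : Prop :=
  ∀ (z : ℂ) (y : ℝ → ℂ), IsSolution q z y →
    ∃ a : ℝ, MemLp y 2 (volume.restrict (Set.Ioi a))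

/-- `τ_q` is in the limit circle case at `-∞`. -/
def LimitCircleAtBot (q : ℝ → ℝ) : Prop :=
  ∀ (z : ℂ) (y : ℝ → ℂ), IsSolution q z y →
    ∃ a : ℝ, MemLp y 2 (volume.restrict (Set.Iio a))

/-- The bracket `[f, g]_x = conj (f x) * g' x - conj (f' x) * g x`. -/
def bracket (f g : ℝ → ℂ) (x : ℝ) : ℂ :=
  (starRingEnd ℂ) (f x) * deriv g x - (starRingEnd ℂ) (deriv f x) * g x

/-- `w₁`, `w₂` are real-valued solutions of `τ_q y = 0`, `w₁` odd and `w₂` even, normalized by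
`[w₁, w₂]_{-∞} = [w₁, w₂]_{∞} = 1`. -/
structure IsNormalizedPair (q : ℝ → ℝ) (w₁ w₂ : ℝ → ℂ) : Prop where
  solution_fst : IsSolution q 0 w₁
  solution_snd : IsSolution q 0 w₂
  real_fst : ∀ x, (w₁ x).im = 0
  real_snd : ∀ x, (w₂ x).im = 0
  odd_fst : ∀ x, w₁ (-x) = -w₁ x
  even_snd : ∀ x, w₂ (-x) = w₂ x
  bracket_atTop : Tendsto (bracket w₁ w₂) atTop (𝓝 1)
  bracket_atBot : Tendsto (bracket w₁ w₂) atBot (𝓝 1)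

/-! ### The maximal domain -/

/-- The complex Hilbert space `L²(ℝ)`. -/
abbrev L2 : Type := Lp ℂ 2 (volume : Measure ℝ)

theorem ACLoc.continuous {f : ℝ → ℂ} (hf : ACLoc f) : Continuous f := by
  rw [continuous_iff_continuousAt]
  intro x
  refine (hf (x - 1) (x + 1)).continuousOn.continuousAt ?_
  rw [Set.uIcc_of_le (by linarith)]
  exact Icc_mem_nhds (by linarith) (by linarith)

theorem ACLoc.ae_differentiableAt {f : ℝ → ℂ} (hf : ACLoc f) :
    ∀ᵐ x : ℝ, DifferentiableAt ℝ f x := by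
  have h : ∀ n : ℕ, ∀ᵐ x : ℝ, x ∈ Set.uIcc (-(n : ℝ)) n → DifferentiableAt ℝ f x := fun n =>
    (hf (-(n : ℝ)) n).boundedVariationOn.ae_differentiableAt_of_mem_uIcc
  filter_upwards [ae_all_iff.2 h] with x hx
  obtain ⟨n, hn⟩ := exists_nat_ge |x|
  refine hx n ?_
  rw [Set.uIcc_of_le (by linarith [abs_nonneg x])]
  exact abs_le.1 hn

theorem IsRegular.add {y z : ℝ → ℂ} (hy : IsRegular y) (hz : IsRegular z) :
    IsRegular (y + z) where
  differentiable := hy.differentiable.add hz.differentiable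
  acLoc a b := (hy.acLoc a b).add (hz.acLoc a b)
  acLoc_deriv a b := by
    have h : deriv (y + z) = deriv y + deriv z := by
      ext x
      exact deriv_add (hy.differentiable x) (hz.differentiable x)
    rw [h]
    exact (hy.acLoc_deriv a b).add (hz.acLoc_deriv a b)

theorem IsRegular.smul {y : ℝ → ℂ} (c : ℂ) (hy : IsRegular y) : IsRegular (c • y) where
  differentiable := hy.differentiable.const_smul c
  acLoc a b := (hy.acLoc a b).const_smul c
  acLoc_deriv a b := by
    have h : deriv (c • y) = c • deriv y := by
      ext x
      exact deriv_const_smul c (hy.differentiable x)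
    rw [h]
    exact (hy.acLoc_deriv a b).const_smul c

theorem IsRegular.zero : IsRegular (0 : ℝ → ℂ) := by
  have h0 : ACLoc (0 : ℝ → ℂ) := fun a b => by
    simpa [AbsolutelyContinuousOnInterval] using tendsto_const_nhds
  refine ⟨differentiable_const (0 : ℂ), h0, ?_⟩
  have h : deriv (0 : ℝ → ℂ) = 0 := by
    ext x
    exact deriv_const x (0 : ℂ)
  rw [h]
  exact h0

theorem tau_zero (q : ℝ → ℝ) : tau q 0 = 0 := by
  have h : deriv (0 : ℝ → ℂ) = 0 := by
    ext x
    exact deriv_const x (0 : ℂ)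
  ext x
  simp [tau, h]

theorem tau_add (q : ℝ → ℝ) {y z : ℝ → ℂ} (hy : IsRegular y) (hz : IsRegular z) :
    tau q (y + z) =ᵐ[volume] tau q y + tau q z := by
  have h : deriv (y + z) = deriv y + deriv z := by
    ext x
    exact deriv_add (hy.differentiable x) (hz.differentiable x)
  filter_upwards [hy.acLoc_deriv.ae_differentiableAt, hz.acLoc_deriv.ae_differentiableAt]
    with x h1 h2
  have h3 : deriv (deriv y + deriv z) x = deriv (deriv y) x + deriv (deriv z) x :=
    deriv_add h1 h2
  simp only [tau, h, h3, Pi.add_apply]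
  ring

theorem tau_smul (q : ℝ → ℝ) (c : ℂ) {y : ℝ → ℂ} (hy : IsRegular y) :
    tau q (c • y) =ᵐ[volume] c • tau q y := by
  have h : deriv (c • y) = c • deriv y := by
    ext x
    exact deriv_const_smul c (hy.differentiable x)
  filter_upwards [hy.acLoc_deriv.ae_differentiableAt] with x h1
  have h3 : deriv (c • deriv y) x = c • deriv (deriv y) x := deriv_const_smul c h1
  simp only [tau, h, h3, Pi.smul_apply, smul_eq_mul]
  ring

/-- The maximal domain: all `y ∈ L²(ℝ)` with `y`, `y'` locally absolutely continuous and
`τ_q y ∈ L²(ℝ)`. Its elements are functions; each is the unique continuous representative of its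
class in `L²(ℝ)`. -/
def maxDomain (q : ℝ → ℝ) : Submodule ℂ (ℝ → ℂ) where
  carrier := {y | IsRegular y ∧ MemLp y 2 volume ∧ MemLp (tau q y) 2 volume}
  zero_mem' := ⟨IsRegular.zero, MemLp.zero, by rw [tau_zero]; exact MemLp.zero⟩
  add_mem' := fun hy hz => ⟨hy.1.add hz.1, hy.2.1.add hz.2.1,
    (memLp_congr_ae (tau_add q hy.1 hz.1)).2 (hy.2.2.add hz.2.2)⟩
  smul_mem' := fun c _ hy => ⟨hy.1.smul c, hy.2.1.const_smul c,
    (memLp_congr_ae (tau_smul q c hy.1)).2 (hy.2.2.const_smul c)⟩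

/-- The class in `L²(ℝ)` of an element of the maximal domain. -/
def toL2 (q : ℝ → ℝ) : maxDomain q →ₗ[ℂ] L2 where
  toFun y := MemLp.toLp (y : ℝ → ℂ) y.2.2.1
  map_add' _ _ := rfl
  map_smul' _ _ := rfl

/-- The class of `τ_q y` in `L²(ℝ)`, for `y` in the maximal domain. -/
def tauL2 (q : ℝ → ℝ) : maxDomain q →ₗ[ℂ] L2 where
  toFun y := MemLp.toLp (tau q (y : ℝ → ℂ)) y.2.2.2
  map_add' y z := by
    rw [← MemLp.toLp_add y.2.2.2 z.2.2.2, MemLp.toLp_eq_toLp_iff]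
    exact tau_add q y.2.1 z.2.1
  map_smul' c y := by
    rw [RingHom.id_apply, ← MemLp.toLp_const_smul c y.2.2.2, MemLp.toLp_eq_toLp_iff]
    exact tau_smul q c y.2.1

theorem toL2_injective (q : ℝ → ℝ) : Function.Injective (toL2 q) := by
  intro y z h
  have h1 : (y : ℝ → ℂ) =ᵐ[volume] (z : ℝ → ℂ) := (MemLp.toLp_eq_toLp_iff y.2.2.1 z.2.2.1).1 h
  exact Subtype.ext
    ((Continuous.ae_eq_iff_eq volume y.2.1.acLoc.continuous z.2.1.acLoc.continuous).1 h1)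

/-- The restriction of the maximal operator `y ↦ τ_q y` in `L²(ℝ)` to the linear subspace `D` of
the maximal domain. For `D = ⊤` it is the maximal operator itself. -/
def restrictedOperator (q : ℝ → ℝ) (D : Submodule ℂ (maxDomain q)) : L2 →ₗ.[ℂ] L2 where
  domain := D.map (toL2 q)
  toFun := (tauL2 q).comp (D.subtype.comp
    (Submodule.equivMapOfInjective (toL2 q) (toL2_injective q) D).symm.toLinearMap)

theorem restrictedOperator_apply (q : ℝ → ℝ) (D : Submodule ℂ (maxDomain q)) (y : maxDomain q)
    (hy : y ∈ D) :
    restrictedOperator q D ⟨toL2 q y, Submodule.mem_map_of_mem hy⟩ = tauL2 q y := by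
  have h : (⟨toL2 q y, Submodule.mem_map_of_mem hy⟩ : D.map (toL2 q)) =
      Submodule.equivMapOfInjective (toL2 q) (toL2_injective q) D ⟨y, hy⟩ := rfl
  change tauL2 q (((Submodule.equivMapOfInjective (toL2 q) (toL2_injective q) D).symm
    ⟨toL2 q y, Submodule.mem_map_of_mem hy⟩ : D) : maxDomain q) = tauL2 q y
  rw [h, LinearEquiv.symm_apply_apply]

/-! ### Boundary values and two-dimensional extensions -/

/-- The boundary values of `f` are `(α₁(f), α₂(f)) = (a 0, a 1)` at `-∞` and
`(β₁(f), β₂(f)) = (b 0, b 1)` at `+∞`, where `α_j(f) = [w_j, f]_{-∞}` and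
`β_j(f) = [w_j, f]_{∞}`. -/
structure HasBoundaryValues (w₁ w₂ f : ℝ → ℂ) (a b : Fin 2 → ℂ) : Prop where
  alpha_one : Tendsto (bracket w₁ f) atBot (𝓝 (a 0))
  alpha_two : Tendsto (bracket w₂ f) atBot (𝓝 (a 1))
  beta_one : Tendsto (bracket w₁ f) atTop (𝓝 (b 0))
  beta_two : Tendsto (bracket w₂ f) atTop (𝓝 (b 1))

theorem bracket_add (w : ℝ → ℂ) {f g : ℝ → ℂ} (hf : Differentiable ℝ f)
    (hg : Differentiable ℝ g) : bracket w (f + g) = bracket w f + bracket w g := by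
  ext x
  have h : deriv (f + g) x = deriv f x + deriv g x := deriv_add (hf x) (hg x)
  simp only [bracket, h, Pi.add_apply]
  ring

theorem bracket_smul (w : ℝ → ℂ) (c : ℂ) {f : ℝ → ℂ} (hf : Differentiable ℝ f) :
    bracket w (c • f) = c • bracket w f := by
  ext x
  have h : deriv (c • f) x = c • deriv f x := deriv_const_smul c (hf x)
  simp only [bracket, h, Pi.smul_apply, smul_eq_mul]
  ring

theorem bracket_zero (w : ℝ → ℂ) : bracket w 0 = 0 := by
  have h : deriv (0 : ℝ → ℂ) = 0 := by
    ext x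
    exact deriv_const x (0 : ℂ)
  ext x
  simp [bracket, h]

/-- The functions in the maximal domain whose boundary values `((α₁, α₂), (β₁, β₂))` lie in the
linear subspace `S` of `ℂ² × ℂ²`. -/
def boundaryDomain (q : ℝ → ℝ) (w₁ w₂ : ℝ → ℂ)
    (S : Submodule ℂ ((Fin 2 → ℂ) × (Fin 2 → ℂ))) : Submodule ℂ (maxDomain q) where
  carrier := {f | ∃ p ∈ S, HasBoundaryValues w₁ w₂ f p.1 p.2}
  zero_mem' := by
    refine ⟨0, S.zero_mem, ?_⟩
    constructor <;> (simp only [Submodule.coe_zero, bracket_zero]; exact tendsto_const_nhds)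
  add_mem' := by
    rintro f g ⟨p, hp, hf⟩ ⟨r, hr, hg⟩
    have hfd := f.2.1.differentiable
    have hgd := g.2.1.differentiable
    refine ⟨p + r, S.add_mem hp hr, ?_⟩
    constructor <;> simp only [Submodule.coe_add, bracket_add _ hfd hgd]
    · exact hf.alpha_one.add hg.alpha_one
    · exact hf.alpha_two.add hg.alpha_two
    · exact hf.beta_one.add hg.beta_one
    · exact hf.beta_two.add hg.beta_two
  smul_mem' := by
    rintro c f ⟨p, hp, hf⟩
    have hfd := f.2.1.differentiable
    refine ⟨c • p, S.smul_mem c hp, ?_⟩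
    constructor <;> simp only [Submodule.coe_smul, bracket_smul _ c hfd]
    · exact hf.alpha_one.const_smul c
    · exact hf.alpha_two.const_smul c
    · exact hf.beta_one.const_smul c
    · exact hf.beta_two.const_smul c

/-- Separated boundary conditions `α₁ ξ cos α - α₂ sin α = 0`, `β₁ η cos β - β₂ sin β = 0`. -/
def separatedCondition (ξ η : ℂ) (α β : ℝ) : Submodule ℂ ((Fin 2 → ℂ) × (Fin 2 → ℂ)) where
  carrier := {p | p.1 0 * ξ * (Real.cos α : ℂ) - p.1 1 * (Real.sin α : ℂ) = 0 ∧
    p.2 0 * η * (Real.cos β : ℂ) - p.2 1 * (Real.sin β : ℂ) = 0}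
  zero_mem' := by simp
  add_mem' := by
    rintro p r ⟨h1, h2⟩ ⟨h3, h4⟩
    constructor
    · simp only [Prod.fst_add, Pi.add_apply]
      linear_combination h1 + h3
    · simp only [Prod.snd_add, Pi.add_apply]
      linear_combination h2 + h4
  smul_mem' := by
    rintro c p ⟨h1, h2⟩
    constructor
    · simp only [Prod.smul_fst, Pi.smul_apply, smul_eq_mul]
      linear_combination c * h1
    · simp only [Prod.smul_snd, Pi.smul_apply, smul_eq_mul]
      linear_combination c * h2

/-- Mixed boundary conditions `(α₁, α₂)ᵀ = M (β₁, β₂)ᵀ`. -/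
def mixedConditionLeft (M : Matrix (Fin 2) (Fin 2) ℂ) :
    Submodule ℂ ((Fin 2 → ℂ) × (Fin 2 → ℂ)) where
  carrier := {p | p.1 = M.mulVec p.2}
  zero_mem' := (Matrix.mulVec_zero M).symm
  add_mem' := by
    rintro p r hp hr
    simp only [Set.mem_ofPred_eq] at hp hr ⊢
    rw [Prod.fst_add, Prod.snd_add, Matrix.mulVec_add, hp, hr]
  smul_mem' := by
    rintro c p hp
    simp only [Set.mem_ofPred_eq] at hp ⊢
    rw [Prod.smul_fst, Prod.smul_snd, Matrix.mulVec_smul, hp]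

/-- Mixed boundary conditions `(β₁, β₂)ᵀ = M (α₁, α₂)ᵀ`. -/
def mixedConditionRight (M : Matrix (Fin 2) (Fin 2) ℂ) :
    Submodule ℂ ((Fin 2 → ℂ) × (Fin 2 → ℂ)) where
  carrier := {p | p.2 = M.mulVec p.1}
  zero_mem' := (Matrix.mulVec_zero M).symm
  add_mem' := by
    rintro p r hp hr
    simp only [Set.mem_ofPred_eq] at hp hr ⊢
    rw [Prod.fst_add, Prod.snd_add, Matrix.mulVec_add, hp, hr]
  smul_mem' := by
    rintro c p hp
    simp only [Set.mem_ofPred_eq] at hp ⊢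
    rw [Prod.smul_fst, Prod.smul_snd, Matrix.mulVec_smul, hp]

/-- The restriction of the maximal operator defined by the boundary condition `S`. -/
def extensionOf (q : ℝ → ℝ) (w₁ w₂ : ℝ → ℂ)
    (S : Submodule ℂ ((Fin 2 → ℂ) × (Fin 2 → ℂ))) : L2 →ₗ.[ℂ] L2 :=
  restrictedOperator q (boundaryDomain q w₁ w₂ S)

/-! ### Parity and self-adjointness with respect to it -/

/-- The parity operator `(P f)(x) = f(-x)` on `L²(ℝ)`. -/
def parity : L2 →ₗᵢ[ℂ] L2 :=
  Lp.compMeasurePreservingₗᵢ ℂ (fun x : ℝ => -x) (Measure.measurePreserving_neg volume)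

/-- A closed densely defined operator `H` in `L²(ℝ)` is `P`-self-adjoint if
`dom H = dom (H* P) = {f | P f ∈ dom H*}` and `H f = P H* P f` for all `f ∈ dom H`. -/
def IsPSelfAdjoint (H : L2 →ₗ.[ℂ] L2) : Prop :=
  Dense (H.domain : Set L2) ∧ H.IsClosed ∧
    (∀ f : L2, f ∈ H.domain ↔ parity f ∈ H.adjoint.domain) ∧
    ∀ (f : H.domain) (g : H.adjoint.domain), (g : L2) = parity (f : L2) →
      H f = parity (H.adjoint g)

end PTSL

end

noncomputable section

namespace PTSL

local notation "conj" => starRingEnd ℂ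

/-! ### Locally absolutely continuous functions -/

/-! Green's formula writes ⟨τf, g⟩ - ⟨f, τg⟩ as the difference of the limits of [f, g] at +∞ and -∞.
Since w₁, w₂ have Wronskian 1, that difference is a sesquilinear form, `boundaryForm`, in the
boundary values of f and g alone.

Two facts reduce questions about adjoints to this form on ℂ² × ℂ²: every vector occurs as boundary
values (`exists_hasBoundaryValues`), and the adjoint of the minimal operator lies in the maximal one
(`exists_of_forall_inner_eq`). Both rest on variation of constants (`exists_tau_eq`): as w₁, w₂ are
square integrable, τy = g is solvable in the maximal domain for every g in L², with zero boundary
values at -∞. Hence the adjoint of the restriction given by a subspace S is the restriction given by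
the annihilator of S (`mem_graph_adjoint`).

As q is even, reflection preserves the maximal domain and acts on boundary values by `boundaryFlip`.
So P-self-adjointness says that S is the flip of its own annihilator
(`isPSelfAdjoint_extensionOf_iff`), which is linear algebra. For mixed conditions with matrix M it
reads M*J = JM, where J swaps the two coordinates. For separated conditions each end contributes a
line, and the flipped form pairs the line at -∞ with the line at +∞; this leaves the single equation
ξη sin α cos β + cos α sin β = 0. -/

theorem _root_.LipschitzWith.comp_absolutelyContinuousOnInterval {X Y : Type*}
    [PseudoMetricSpace X] [PseudoMetricSpace Y] {K : NNReal} {φ : X → Y} (hφ : LipschitzWith K φ)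
    {f : ℝ → X} {a b : ℝ} (hf : AbsolutelyContinuousOnInterval f a b) :
    AbsolutelyContinuousOnInterval (φ ∘ f) a b := by
  unfold AbsolutelyContinuousOnInterval at hf ⊢
  refine squeeze_zero (fun t => Finset.sum_nonneg fun i _ => dist_nonneg) (fun t => ?_)
    (by simpa using hf.const_mul (K : ℝ))
  rw [Finset.mul_sum]
  exact Finset.sum_le_sum fun i _ => hφ.dist_le_mul _ _

theorem ACLoc.mul {f g : ℝ → ℂ} (hf : ACLoc f) (hg : ACLoc g) : ACLoc (fun x => f x * g x) :=
  fun a b => (hf a b).smul (hg a b)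

theorem ACLoc.add {f g : ℝ → ℂ} (hf : ACLoc f) (hg : ACLoc g) : ACLoc (fun x => f x + g x) :=
  fun a b => AbsolutelyContinuousOnInterval.add (hf a b) (hg a b)

theorem ACLoc.sub {f g : ℝ → ℂ} (hf : ACLoc f) (hg : ACLoc g) : ACLoc (fun x => f x - g x) :=
  fun a b => AbsolutelyContinuousOnInterval.sub (hf a b) (hg a b)

theorem ACLoc.const (c : ℂ) : ACLoc (fun _ => c) := fun _ _ =>
  (LipschitzWith.const c).lipschitzOnWith.absolutelyContinuousOnInterval

theorem ACLoc.conj {f : ℝ → ℂ} (hf : ACLoc f) : ACLoc (fun x => (starRingEnd ℂ) (f x)) :=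
  fun a b => (Complex.isometry_conj.lipschitz).comp_absolutelyContinuousOnInterval (hf a b)

theorem acLoc_of_re_im {f : ℝ → ℂ}
    (hr : ∀ a b, AbsolutelyContinuousOnInterval (fun x => (f x).re) a b)
    (hi : ∀ a b, AbsolutelyContinuousOnInterval (fun x => (f x).im) a b) : ACLoc f := by
  have key : ∀ {g : ℝ → ℝ}, (∀ a b, AbsolutelyContinuousOnInterval g a b) →
      ACLoc (fun x => (g x : ℂ)) := fun hg a b =>
    (Complex.isometry_ofReal.lipschitz).comp_absolutelyContinuousOnInterval (hg a b)
  have h := (key hr).add ((key hi).mul (ACLoc.const Complex.I))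
  simpa only [Complex.re_add_im] using h

theorem _root_.MeasureTheory.LocallyIntegrable.re_complex {g : ℝ → ℂ}
    (hg : LocallyIntegrable g volume) : LocallyIntegrable (fun x => (g x).re) volume := fun x =>
  let ⟨s, hs, h⟩ := hg x
  ⟨s, hs, Integrable.re h⟩

theorem _root_.MeasureTheory.LocallyIntegrable.im_complex {g : ℝ → ℂ}
    (hg : LocallyIntegrable g volume) : LocallyIntegrable (fun x => (g x).im) volume := fun x =>
  let ⟨s, hs, h⟩ := hg x
  ⟨s, hs, Integrable.im h⟩

theorem _root_.MeasureTheory.LocallyIntegrable.intervalIntegrable_real {E : Type*}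
    [NormedAddCommGroup E] {g : ℝ → E} (hg : LocallyIntegrable g volume) (a b : ℝ) :
    IntervalIntegrable g volume a b :=
  (hg.integrableOn_isCompact isCompact_uIcc).intervalIntegrable

theorem locallyIntegrable_of_intervalIntegrable {E : Type*} [NormedAddCommGroup E] {g : ℝ → E}
    (hg : ∀ a b, IntervalIntegrable g volume a b) : LocallyIntegrable g volume := fun x => by
  refine ⟨Set.Icc (x - 1) (x + 1), Icc_mem_nhds (by linarith) (by linarith), ?_⟩
  exact (intervalIntegrable_iff_integrableOn_Icc_of_le (by linarith)).1 (hg _ _)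

/-- A primitive of a locally integrable function is locally absolutely continuous. -/
theorem acLoc_primitive {g : ℝ → ℂ} (hg : LocallyIntegrable g volume) :
    ACLoc (fun x => ∫ t in (0 : ℝ)..x, g t) := by
  have hreal : ∀ {u : ℝ → ℝ}, LocallyIntegrable u volume → ∀ a b : ℝ,
      AbsolutelyContinuousOnInterval (fun x => ∫ t in (0 : ℝ)..x, u t) a b := by
    intro u hu a b
    -- The symmetric interval is chosen to contain a, b and the base point 0 of the primitive.
    refine ((hu.intervalIntegrable_real (-(|a| + |b|)) (|a| + |b|)
      ).absolutelyContinuousOnInterval_intervalIntegral (c := 0) ?_).mono ?_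
    · rw [Set.uIcc_of_le (by linarith [abs_nonneg a, abs_nonneg b])]
      constructor <;> linarith [abs_nonneg a, abs_nonneg b]
    · rw [Set.uIcc_of_le (show -(|a| + |b|) ≤ |a| + |b| by
        linarith [abs_nonneg a, abs_nonneg b])]
      refine Set.uIcc_subset_Icc ⟨?_, ?_⟩ ⟨?_, ?_⟩ <;>
        linarith [neg_abs_le a, neg_abs_le b, le_abs_self a, le_abs_self b, abs_nonneg a,
          abs_nonneg b]
  refine acLoc_of_re_im (fun a b => ?_) (fun a b => ?_)
  · convert hreal hg.re_complex a b using 2 with x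
    exact ((Complex.reCLM.intervalIntegral_comp_comm (hg.intervalIntegrable_real 0 x))).symm
  · convert hreal hg.im_complex a b using 2 with x
    exact ((Complex.imCLM.intervalIntegral_comp_comm (hg.intervalIntegrable_real 0 x))).symm

theorem acLoc_of_eq_primitive {f g : ℝ → ℂ} (hg : LocallyIntegrable g volume)
    (hf : ∀ x, f x = f 0 + ∫ t in (0 : ℝ)..x, g t) : ACLoc f := by
  have h := (ACLoc.const (f 0)).add (acLoc_primitive hg)
  rwa [← funext hf] at h

theorem ae_hasDerivAt_of_eq_primitive {f g : ℝ → ℂ} (hg : LocallyIntegrable g volume)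
    (hf : ∀ x, f x = f 0 + ∫ t in (0 : ℝ)..x, g t) : ∀ᵐ x : ℝ, HasDerivAt f (g x) x := by
  filter_upwards [LocallyIntegrable.ae_hasDerivAt_integral hg] with x hx
  rw [funext hf]
  exact (hx 0).const_add (f 0)

/-- The fundamental theorem of calculus for locally absolutely continuous functions. -/
theorem ACLoc.integral_eq_sub {f g : ℝ → ℂ} (hf : ACLoc f) (hg : LocallyIntegrable g volume)
    (hfg : ∀ᵐ x : ℝ, HasDerivAt f (g x) x) (a b : ℝ) : ∫ t in a..b, g t = f b - f a := by
  -- The difference of `f` and the primitive of `g` is absolutely continuous with derivative zero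
  -- almost everywhere, hence constant.
  have hac := hf.sub (acLoc_primitive hg)
  obtain ⟨C, hC⟩ := (hac a b).const_of_ae_hasDerivAt_zero (by
    filter_upwards [hfg, LocallyIntegrable.ae_hasDerivAt_integral hg] with x h1 h2 _
    simpa using! h1.sub (h2 0))
  have ha := hC a Set.left_mem_uIcc
  have hb := hC b Set.right_mem_uIcc
  rw [← intervalIntegral.integral_interval_sub_left (hg.intervalIntegrable_real 0 b)
    (hg.intervalIntegrable_real 0 a)]
  linear_combination ha - hb

theorem ACLoc.eq_of_ae_hasDerivAt_zero {f : ℝ → ℂ} (hf : ACLoc f)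
    (h0 : ∀ᵐ x : ℝ, HasDerivAt f 0 x) (a b : ℝ) : f a = f b := by
  have h := hf.integral_eq_sub (g := fun _ => 0) (locallyIntegrable_const 0) h0 a b
  rw [intervalIntegral.integral_zero] at h
  exact (sub_eq_zero.1 h.symm).symm

/-- A locally absolutely continuous function whose derivative agrees almost everywhere with a
continuous function is differentiable everywhere. -/
theorem ACLoc.hasDerivAt_of_continuous {f v : ℝ → ℂ} (hf : ACLoc f) (hv : Continuous v)
    (hfv : ∀ᵐ x : ℝ, HasDerivAt f (v x) x) (x : ℝ) : HasDerivAt f (v x) x := by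
  have h : f = fun x => f 0 + ∫ t in (0 : ℝ)..x, v t := by
    ext y
    rw [hf.integral_eq_sub hv.locallyIntegrable hfv]
    ring
  rw [h]
  exact (intervalIntegral.integral_hasDerivAt_right (hv.intervalIntegrable 0 x)
    (hv.stronglyMeasurableAtFilter _ _) hv.continuousAt).const_add (f 0)

theorem ACLoc.locallyIntegrable_deriv {f : ℝ → ℂ} (hf : ACLoc f) :
    LocallyIntegrable (deriv f) volume := by
  refine locallyIntegrable_of_intervalIntegrable fun a b => ?_
  have hre : AbsolutelyContinuousOnInterval (fun x => (f x).re) a b :=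
    Complex.reCLM.lipschitz.comp_absolutelyContinuousOnInterval (hf a b)
  have him : AbsolutelyContinuousOnInterval (fun x => (f x).im) a b :=
    Complex.imCLM.lipschitz.comp_absolutelyContinuousOnInterval (hf a b)
  have h1 := hre.intervalIntegrable_deriv
  have h2 := him.intervalIntegrable_deriv
  have h3 : IntervalIntegrable (fun x => ((deriv (fun x => (f x).re) x : ℝ) : ℂ) +
      ((deriv (fun x => (f x).im) x : ℝ) : ℂ) * Complex.I) volume a b :=
    IntervalIntegrable.add ⟨h1.1.ofReal, h1.2.ofReal⟩
      (IntervalIntegrable.mul_const ⟨h2.1.ofReal, h2.2.ofReal⟩ Complex.I)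
  refine h3.congr_ae (ae_restrict_of_ae ?_)
  filter_upwards [hf.ae_differentiableAt] with x hx
  have hr : HasDerivAt (fun x => (f x).re) (deriv f x).re x :=
    Complex.reCLM.hasFDerivAt.comp_hasDerivAt x hx.hasDerivAt
  have hi : HasDerivAt (fun x => (f x).im) (deriv f x).im x :=
    Complex.imCLM.hasFDerivAt.comp_hasDerivAt x hx.hasDerivAt
  rw [hr.deriv, hi.deriv, Complex.re_add_im]

theorem ACLoc.comp_neg {f : ℝ → ℂ} (hf : ACLoc f) : ACLoc (fun x => f (-x)) := by
  have hd := hf.locallyIntegrable_deriv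
  have hfd : ∀ᵐ x : ℝ, HasDerivAt f (deriv f x) x := by
    filter_upwards [hf.ae_differentiableAt] with x hx using hx.hasDerivAt
  refine acLoc_of_eq_primitive (g := fun t => -deriv f (-t))
    (locallyIntegrable_of_intervalIntegrable fun a b => ?_) fun x => ?_
  · simpa using! ((hd.intervalIntegrable_real (-a) (-b)).comp_sub_left 0).neg
  · rw [intervalIntegral.integral_neg, intervalIntegral.integral_comp_neg (fun t => deriv f t),
      hf.integral_eq_sub hd hfd]
    simp

theorem _root_.HasDerivAt.comp_neg_real {f : ℝ → ℂ} {f' : ℂ} {x : ℝ}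
    (hf : HasDerivAt f f' (-x)) : HasDerivAt (fun t => f (-t)) (-f') x := by
  simpa [Function.comp_def] using hf.scomp x (hasDerivAt_neg x)

/-! ### Regular functions, brackets and Green's formula -/

theorem IsRegular.ae_hasDerivAt_deriv {f : ℝ → ℂ} (hf : IsRegular f) :
    ∀ᵐ x : ℝ, HasDerivAt (deriv f) (deriv (deriv f) x) x := by
  filter_upwards [hf.acLoc_deriv.ae_differentiableAt] with x hx using hx.hasDerivAt

theorem hasDerivAt_conj {f : ℝ → ℂ} {f' : ℂ} {x : ℝ} (hf : HasDerivAt f f' x) :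
    HasDerivAt (fun t => conj (f t)) (conj f') x :=
  (Complex.conjCLE.toContinuousLinearMap.hasFDerivAt.comp_hasDerivAt x hf :)

theorem acLoc_bracket {f g : ℝ → ℂ} (hf : IsRegular f) (hg : IsRegular g) :
    ACLoc (bracket f g) :=
  (hf.acLoc.conj.mul hg.acLoc_deriv).sub (hf.acLoc_deriv.conj.mul hg.acLoc)

theorem ae_hasDerivAt_bracket (q : ℝ → ℝ) {f g : ℝ → ℂ} (hf : IsRegular f) (hg : IsRegular g) :
    ∀ᵐ x : ℝ, HasDerivAt (bracket f g)
      (conj (tau q f x) * g x - conj (f x) * tau q g x) x := by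
  filter_upwards [hf.ae_hasDerivAt_deriv, hg.ae_hasDerivAt_deriv] with x h1 h2
  have h3 := ((hasDerivAt_conj (hf.differentiable x).hasDerivAt).mul h2).sub
    ((hasDerivAt_conj h1).mul (hg.differentiable x).hasDerivAt)
  refine h3.congr_deriv ?_
  simp only [tau, map_sub, map_neg, map_mul, Complex.conj_ofReal]
  ring

theorem integrable_conj_mul {f g : ℝ → ℂ} (hf : MemLp f 2 volume) (hg : MemLp g 2 volume) :
    Integrable (fun x => conj (f x) * g x) volume :=
  hf.star.integrable_mul hg

theorem inner_toLp {f g : ℝ → ℂ} (hf : MemLp f 2 volume) (hg : MemLp g 2 volume) :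
    inner ℂ (hf.toLp f) (hg.toLp g) = ∫ x, conj (f x) * g x := by
  rw [L2.inner_def]
  refine integral_congr_ae ?_
  filter_upwards [hf.coeFn_toLp, hg.coeFn_toLp] with x h1 h2
  rw [h1, h2, RCLike.inner_apply, mul_comm]

/-- **Green's formula** on the maximal domain. -/
theorem exists_tendsto_bracket (q : ℝ → ℝ) (f g : maxDomain q) :
    ∃ lt lb : ℂ, Tendsto (bracket f g) atTop (𝓝 lt) ∧ Tendsto (bracket f g) atBot (𝓝 lb) ∧
      inner ℂ (tauL2 q f) (toL2 q g) - inner ℂ (toL2 q f) (tauL2 q g) = lt - lb := by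
  have hi1 := integrable_conj_mul f.2.2.2 g.2.2.1
  have hi2 := integrable_conj_mul f.2.2.1 g.2.2.2
  set G : ℝ → ℂ := fun x =>
    conj (tau q f x) * (g : ℝ → ℂ) x - conj ((f : ℝ → ℂ) x) * tau q g x with hG
  have hGi : Integrable G volume := hi1.sub hi2
  -- The bracket is a primitive of the integrable function `G`, so it converges at both ends and its
  -- total increment is the integral of `G`.
  have hB : ∀ x, bracket f g 0 + ∫ t in (0 : ℝ)..x, G t = bracket f g x := fun x => by
    rw [(acLoc_bracket f.2.1 g.2.1).integral_eq_sub hGi.locallyIntegrable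
      (ae_hasDerivAt_bracket q f.2.1 g.2.1)]
    ring
  refine ⟨_, _, ((intervalIntegral_tendsto_integral_Ioi 0 hGi.integrableOn
    tendsto_id).const_add (bracket f g 0)).congr hB,
    ((intervalIntegral_tendsto_integral_Iic 0 hGi.integrableOn
    tendsto_id).const_sub (bracket f g 0)).congr fun x => ?_, ?_⟩
  · rw [id, intervalIntegral.integral_symm, sub_neg_eq_add, hB]
  · have h1 : inner ℂ (tauL2 q f) (toL2 q g) = ∫ x, conj (tau q f x) * (g : ℝ → ℂ) x :=
      inner_toLp f.2.2.2 g.2.2.1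
    have h2 : inner ℂ (toL2 q f) (tauL2 q g) = ∫ x, conj ((f : ℝ → ℂ) x) * tau q g x :=
      inner_toLp f.2.2.1 g.2.2.2
    rw [h1, h2, ← integral_sub hi1 hi2,
      ← intervalIntegral.integral_Iic_add_Ioi hGi.integrableOn (hGi.integrableOn (s := Set.Ioi 0))]
    ring

/-! ### The normalized fundamental system -/

theorem conj_eq_of_real {w : ℝ → ℂ} (hw : ∀ x, (w x).im = 0) (x : ℝ) : conj (w x) = w x :=
  Complex.conj_eq_iff_im.2 (hw x)

theorem conj_deriv_eq_of_real {w : ℝ → ℂ} (hd : Differentiable ℝ w) (hw : ∀ x, (w x).im = 0)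
    (x : ℝ) : conj (deriv w x) = deriv w x := by
  have h := hasDerivAt_conj (hd x).hasDerivAt
  rw [funext (conj_eq_of_real hw)] at h
  exact h.unique (hd x).hasDerivAt

theorem memLp_two_of_continuous {f : ℝ → ℂ} (hf : Continuous f) {a b : ℝ}
    (ha : MemLp f 2 (volume.restrict (Set.Ioi a))) (hb : MemLp f 2 (volume.restrict (Set.Iio b))) :
    MemLp f 2 volume := by
  rw [memLp_two_iff_integrable_sq_norm hf.aestronglyMeasurable] at ha hb ⊢
  have hc : IntegrableOn (fun x => ‖f x‖ ^ 2) (Set.Icc b a) volume :=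
    (hf.norm.pow 2).continuousOn.integrableOn_compact isCompact_Icc
  rw [← integrableOn_univ]
  refine ((IntegrableOn.union hb hc).union ha).mono_set fun x _ => ?_
  by_cases h1 : x < b
  · exact Or.inl (Or.inl h1)
  · by_cases h2 : a < x
    · exact Or.inr h2
    · exact Or.inl (Or.inr ⟨not_lt.1 h1, not_lt.1 h2⟩)

theorem IsSolution.tau_ae_eq_zero {q : ℝ → ℝ} {w : ℝ → ℂ} (hw : IsSolution q 0 w) :
    tau q w =ᵐ[volume] 0 := by
  filter_upwards [hw.2] with x hx
  simpa using hx

/-- The limit circle hypotheses enter here, at spectral parameter 0: they control the two tails, and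
continuity controls the compact middle. -/
theorem IsSolution.mem_maxDomain {q : ℝ → ℝ} (htop : LimitCircleAtTop q)
    (hbot : LimitCircleAtBot q) {w : ℝ → ℂ} (hw : IsSolution q 0 w) : w ∈ maxDomain q := by
  obtain ⟨a, ha⟩ := htop 0 w hw
  obtain ⟨b, hb⟩ := hbot 0 w hw
  exact ⟨hw.1, memLp_two_of_continuous hw.1.acLoc.continuous ha hb,
    (memLp_congr_ae hw.tau_ae_eq_zero).2 MemLp.zero⟩

theorem tauL2_eq_toLp {q : ℝ → ℝ} {y : maxDomain q} {g : ℝ → ℂ} (hg : MemLp g 2 volume)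
    (h : tau q y =ᵐ[volume] g) : tauL2 q y = hg.toLp g :=
  (MemLp.toLp_eq_toLp_iff y.2.2.2 hg).2 h

theorem tauL2_eq_zero {q : ℝ → ℝ} {y : maxDomain q} (h : IsSolution q 0 y) : tauL2 q y = 0 :=
  tauL2_eq_toLp MemLp.zero h.tau_ae_eq_zero

namespace IsNormalizedPair

variable {q : ℝ → ℝ} {w₁ w₂ : ℝ → ℂ}

theorem conj_fst (hw : IsNormalizedPair q w₁ w₂) (x : ℝ) : conj (w₁ x) = w₁ x :=
  conj_eq_of_real hw.real_fst x

theorem conj_snd (hw : IsNormalizedPair q w₁ w₂) (x : ℝ) : conj (w₂ x) = w₂ x :=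
  conj_eq_of_real hw.real_snd x

theorem conj_deriv_fst (hw : IsNormalizedPair q w₁ w₂) (x : ℝ) :
    conj (deriv w₁ x) = deriv w₁ x :=
  conj_deriv_eq_of_real hw.solution_fst.1.differentiable hw.real_fst x

theorem conj_deriv_snd (hw : IsNormalizedPair q w₁ w₂) (x : ℝ) :
    conj (deriv w₂ x) = deriv w₂ x :=
  conj_deriv_eq_of_real hw.solution_snd.1.differentiable hw.real_snd x

theorem bracket_fst (hw : IsNormalizedPair q w₁ w₂) (f : ℝ → ℂ) (x : ℝ) :
    bracket w₁ f x = w₁ x * deriv f x - deriv w₁ x * f x := by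
  rw [bracket, hw.conj_fst, hw.conj_deriv_fst]

theorem bracket_snd (hw : IsNormalizedPair q w₁ w₂) (f : ℝ → ℂ) (x : ℝ) :
    bracket w₂ f x = w₂ x * deriv f x - deriv w₂ x * f x := by
  rw [bracket, hw.conj_snd, hw.conj_deriv_snd]

/-- By Lagrange's identity the bracket of two solutions has derivative zero almost everywhere, so it
is constant and equals its limit at +∞. -/
theorem wronskian (hw : IsNormalizedPair q w₁ w₂) (x : ℝ) :
    w₁ x * deriv w₂ x - deriv w₁ x * w₂ x = 1 := by
  rw [← hw.bracket_fst]
  have hr1 := hw.solution_fst.1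
  have hr2 := hw.solution_snd.1
  have h0 : ∀ᵐ x : ℝ, HasDerivAt (bracket w₁ w₂) 0 x := by
    filter_upwards [ae_hasDerivAt_bracket q hr1 hr2, hw.solution_fst.tau_ae_eq_zero,
      hw.solution_snd.tau_ae_eq_zero] with x h h1 h2
    simpa [h1, h2] using h
  have hc : bracket w₁ w₂ = fun _ => bracket w₁ w₂ x :=
    funext fun y => (acLoc_bracket hr1 hr2).eq_of_ae_hasDerivAt_zero h0 y x
  have hl := hw.bracket_atTop
  rw [hc] at hl
  exact tendsto_nhds_unique tendsto_const_nhds hl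

/-- This is the Plücker identity for 2 × 2 determinants with the Wronskian set to 1. Passing to the
limit expresses the boundary term of Green's formula through boundary values. -/
theorem bracket_eq (hw : IsNormalizedPair q w₁ w₂) (f g : ℝ → ℂ) (x : ℝ) :
    bracket f g x =
      conj (bracket w₁ f x) * bracket w₂ g x - conj (bracket w₂ f x) * bracket w₁ g x := by
  simp only [map_sub, map_mul, hw.conj_fst, hw.conj_snd, hw.conj_deriv_fst, hw.conj_deriv_snd,
    bracket]
  linear_combination (-(conj (f x) * deriv g x) + conj (deriv f x) * g x) * hw.wronskian x

end IsNormalizedPair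

/-! ### Variation of constants -/

/-- Properties of the primitive of an integrable function that vanishes at `-∞`. -/
theorem primitive_from_atBot {u : ℝ → ℂ} (hu : Integrable u volume) :
    ACLoc (fun x => ∫ t in Set.Iic x, u t) ∧
    (∀ᵐ x : ℝ, HasDerivAt (fun x => ∫ t in Set.Iic x, u t) (u x) x) ∧
    (∀ x : ℝ, ‖∫ t in Set.Iic x, u t‖ ≤ ∫ t, ‖u t‖) ∧
    Tendsto (fun x => ∫ t in Set.Iic x, u t) atBot (𝓝 0) ∧
    Tendsto (fun x => ∫ t in Set.Iic x, u t) atTop (𝓝 (∫ t, u t)) := by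
  have hprim : ∀ x : ℝ, ∫ t in Set.Iic x, u t =
      (∫ t in Set.Iic (0 : ℝ), u t) + ∫ t in (0 : ℝ)..x, u t := fun x => by
    rw [← intervalIntegral.integral_Iic_sub_Iic hu.integrableOn hu.integrableOn]
    ring
  refine ⟨acLoc_of_eq_primitive hu.locallyIntegrable hprim,
    ae_hasDerivAt_of_eq_primitive hu.locallyIntegrable hprim, fun x => ?_, ?_, ?_⟩
  · exact (norm_integral_le_integral_norm _).trans
      (setIntegral_le_integral hu.norm (Eventually.of_forall fun _ => norm_nonneg _))
  · have h := (intervalIntegral_tendsto_integral_Iic 0 hu.integrableOn tendsto_id).const_sub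
      (∫ t in Set.Iic (0 : ℝ), u t)
    rw [sub_self] at h
    refine h.congr fun x => ?_
    rw [hprim x, id, intervalIntegral.integral_symm 0 x]
    ring
  · have h := (intervalIntegral_tendsto_integral_Ioi 0 hu.integrableOn tendsto_id).const_add
      (∫ t in Set.Iic (0 : ℝ), u t)
    rw [intervalIntegral.integral_Iic_add_Ioi hu.integrableOn hu.integrableOn] at h
    exact h.congr fun x => (hprim x).symm

theorem memLp_mul_of_bounded {w A : ℝ → ℂ} (hw : MemLp w 2 volume) (hA : Continuous A) {C : ℝ}
    (hC : ∀ x, ‖A x‖ ≤ C) : MemLp (fun x => w x * A x) 2 volume := by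
  refine hw.of_le_mul (c := C) (hw.1.mul hA.aestronglyMeasurable)
    (Eventually.of_forall fun x => ?_)
  rw [norm_mul, mul_comm]
  exact mul_le_mul_of_nonneg_right (hC x) (norm_nonneg _)

/-- The solution is y = w₁A - w₂B, where A and B are the primitives from -∞ of w₂g and w₁g. These
are bounded because both products are integrable, so y is in L². Its brackets with w₁ and w₂ are -B
and -A, which gives the boundary values at both ends. -/
theorem IsNormalizedPair.exists_tau_eq {q : ℝ → ℝ} {w₁ w₂ : ℝ → ℂ}
    (hw : IsNormalizedPair q w₁ w₂) (h₁ : w₁ ∈ maxDomain q) (h₂ : w₂ ∈ maxDomain q)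
    {g : ℝ → ℂ} (hg : MemLp g 2 volume) :
    ∃ y : maxDomain q, tau q y =ᵐ[volume] g ∧ HasBoundaryValues w₁ w₂ y 0
      ![-∫ x, conj (w₁ x) * g x, -∫ x, conj (w₂ x) * g x] := by
  obtain ⟨hAac, hAd, hAb, hA0, hA1⟩ := primitive_from_atBot (integrable_conj_mul h₂.2.1 hg)
  obtain ⟨hBac, hBd, hBb, hB0, hB1⟩ := primitive_from_atBot (integrable_conj_mul h₁.2.1 hg)
  set A : ℝ → ℂ := fun x => ∫ t in Set.Iic x, conj (w₂ t) * g t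
  set B : ℝ → ℂ := fun x => ∫ t in Set.Iic x, conj (w₁ t) * g t
  have hr₁ := h₁.1
  have hr₂ := h₂.1
  set y : ℝ → ℂ := fun x => w₁ x * A x - w₂ x * B x with hy
  have hyac : ACLoc y := (hr₁.acLoc.mul hAac).sub (hr₂.acLoc.mul hBac)
  set v : ℝ → ℂ := fun x => deriv w₁ x * A x - deriv w₂ x * B x with hv
  have hvac : ACLoc v := (hr₁.acLoc_deriv.mul hAac).sub (hr₂.acLoc_deriv.mul hBac)
  -- The terms w₁w₂g cancel, so y' = v almost everywhere; continuity of v upgrades this to every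
  -- point.
  have hyd : ∀ x, HasDerivAt y (v x) x := by
    refine hyac.hasDerivAt_of_continuous hvac.continuous ?_
    filter_upwards [hAd, hBd] with x hA hB
    have h := ((hr₁.differentiable x).hasDerivAt.mul hA).sub
      ((hr₂.differentiable x).hasDerivAt.mul hB)
    refine h.congr_deriv ?_
    rw [hw.conj_fst, hw.conj_snd]
    ring
  have hdy : deriv y = v := funext fun x => (hyd x).deriv
  have hyr : IsRegular y := ⟨fun x => (hyd x).differentiableAt, hyac, by rwa [hdy]⟩
  have htau : tau q y =ᵐ[volume] g := by
    filter_upwards [hAd, hBd, hr₁.ae_hasDerivAt_deriv, hr₂.ae_hasDerivAt_deriv,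
      hw.solution_fst.tau_ae_eq_zero, hw.solution_snd.tau_ae_eq_zero] with x hA hB hw1 hw2 ht1 ht2
    have h := (hw1.mul hA).sub (hw2.mul hB)
    have h' : deriv v x = _ := h.deriv
    rw [tau, hdy, h', hw.conj_fst, hw.conj_snd]
    simp only [tau, Pi.zero_apply] at ht1 ht2
    linear_combination A x * ht1 - B x * ht2 + g x * hw.wronskian x
  have hyL : MemLp y 2 volume :=
    (memLp_mul_of_bounded h₁.2.1 hAac.continuous hAb).sub
      (memLp_mul_of_bounded h₂.2.1 hBac.continuous hBb)
  have hb1 : bracket w₁ y = fun x => -B x := by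
    ext x
    rw [hw.bracket_fst, hdy]
    linear_combination -B x * hw.wronskian x
  have hb2 : bracket w₂ y = fun x => -A x := by
    ext x
    rw [hw.bracket_snd, hdy]
    linear_combination -A x * hw.wronskian x
  refine ⟨⟨y, hyr, hyL, (memLp_congr_ae htau).2 hg⟩, htau, ?_, ?_, ?_, ?_⟩
  · simpa [hb1] using hB0.neg
  · simpa [hb2] using hA0.neg
  · simpa [hb1] using hB1.neg
  · simpa [hb2] using hA1.neg

/-! ### Boundary values -/

/-- The sesquilinear form on boundary values given by Green's formula. -/
def boundaryForm (p r : (Fin 2 → ℂ) × (Fin 2 → ℂ)) : ℂ :=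
  (conj (p.2 0) * r.2 1 - conj (p.2 1) * r.2 0) - (conj (p.1 0) * r.1 1 - conj (p.1 1) * r.1 0)

/-- The effect of the parity operator on boundary values. -/
def boundaryFlip (p : (Fin 2 → ℂ) × (Fin 2 → ℂ)) : (Fin 2 → ℂ) × (Fin 2 → ℂ) :=
  (![p.2 0, -p.2 1], ![p.1 0, -p.1 1])

theorem HasBoundaryValues.unique {w₁ w₂ f : ℝ → ℂ} {a b a' b' : Fin 2 → ℂ}
    (h : HasBoundaryValues w₁ w₂ f a b) (h' : HasBoundaryValues w₁ w₂ f a' b') :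
    a = a' ∧ b = b' := by
  constructor <;> ext i <;> fin_cases i
  · exact tendsto_nhds_unique h.alpha_one h'.alpha_one
  · exact tendsto_nhds_unique h.alpha_two h'.alpha_two
  · exact tendsto_nhds_unique h.beta_one h'.beta_one
  · exact tendsto_nhds_unique h.beta_two h'.beta_two

theorem HasBoundaryValues.add {w₁ w₂ f g : ℝ → ℂ} {a b a' b' : Fin 2 → ℂ}
    (hf : Differentiable ℝ f) (hg : Differentiable ℝ g)
    (h : HasBoundaryValues w₁ w₂ f a b) (h' : HasBoundaryValues w₁ w₂ g a' b') :
    HasBoundaryValues w₁ w₂ (f + g) (a + a') (b + b') := by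
  constructor <;> rw [bracket_add _ hf hg]
  · exact h.alpha_one.add h'.alpha_one
  · exact h.alpha_two.add h'.alpha_two
  · exact h.beta_one.add h'.beta_one
  · exact h.beta_two.add h'.beta_two

theorem HasBoundaryValues.smul {w₁ w₂ f : ℝ → ℂ} {a b : Fin 2 → ℂ} (c : ℂ)
    (hf : Differentiable ℝ f) (h : HasBoundaryValues w₁ w₂ f a b) :
    HasBoundaryValues w₁ w₂ (c • f) (c • a) (c • b) := by
  constructor <;> rw [bracket_smul _ c hf]
  · exact h.alpha_one.const_smul c
  · exact h.alpha_two.const_smul c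
  · exact h.beta_one.const_smul c
  · exact h.beta_two.const_smul c

theorem exists_boundaryValues {q : ℝ → ℝ} {w₁ w₂ : ℝ → ℂ} (h₁ : w₁ ∈ maxDomain q)
    (h₂ : w₂ ∈ maxDomain q) (f : maxDomain q) :
    ∃ p : (Fin 2 → ℂ) × (Fin 2 → ℂ), HasBoundaryValues w₁ w₂ f p.1 p.2 := by
  obtain ⟨t₁, b₁, ht₁, hb₁, -⟩ := exists_tendsto_bracket q ⟨w₁, h₁⟩ f
  obtain ⟨t₂, b₂, ht₂, hb₂, -⟩ := exists_tendsto_bracket q ⟨w₂, h₂⟩ f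
  exact ⟨(![b₁, b₂], ![t₁, t₂]), hb₁, hb₂, ht₁, ht₂⟩

/-! ### Reflection -/

theorem parity_toLp {f : ℝ → ℂ} (hf : MemLp f 2 volume) :
    parity (hf.toLp f) =
      (hf.comp_measurePreserving (Measure.measurePreserving_neg volume)).toLp
        (fun x => f (-x)) := rfl

theorem parity_parity (f : L2) : parity (parity f) = f := by
  rw [← Lp.toLp_coeFn f (Lp.memLp f), parity_toLp, parity_toLp]
  simp

theorem deriv_comp_neg_eq {f : ℝ → ℂ} (hf : Differentiable ℝ f) :
    deriv (fun x => f (-x)) = fun x => -deriv f (-x) :=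
  funext fun x => ((hf (-x)).hasDerivAt.comp_neg_real).deriv

theorem IsRegular.comp_neg {f : ℝ → ℂ} (hf : IsRegular f) : IsRegular (fun x => f (-x)) where
  differentiable := fun x => ((hf.differentiable (-x)).hasDerivAt.comp_neg_real).differentiableAt
  acLoc := hf.acLoc.comp_neg
  acLoc_deriv := by
    rw [deriv_comp_neg_eq hf.differentiable]
    exact fun a b => (hf.acLoc_deriv.comp_neg a b).neg

theorem tau_comp_neg {q : ℝ → ℝ} (heven : ∀ x, q (-x) = q x) {f : ℝ → ℂ} (hf : IsRegular f) :
    tau q (fun x => f (-x)) = fun x => tau q f (-x) := by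
  ext x
  have h : deriv (fun x => -deriv f (-x)) x = deriv (deriv f) (-x) := by
    have h2 := deriv_comp_neg (deriv f) x
    rw [deriv.fun_neg, h2, neg_neg]
  rw [tau, tau, deriv_comp_neg_eq hf.differentiable, h, heven]

/-- The reflection `x ↦ f (-x)` on the maximal domain. -/
def reflect {q : ℝ → ℝ} (heven : ∀ x, q (-x) = q x) (f : maxDomain q) : maxDomain q :=
  ⟨fun x => (f : ℝ → ℂ) (-x), f.2.1.comp_neg,
    f.2.2.1.comp_measurePreserving (Measure.measurePreserving_neg volume), by
    rw [tau_comp_neg heven f.2.1]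
    exact f.2.2.2.comp_measurePreserving (Measure.measurePreserving_neg volume)⟩

theorem toL2_reflect {q : ℝ → ℝ} (heven : ∀ x, q (-x) = q x) (f : maxDomain q) :
    toL2 q (reflect heven f) = parity (toL2 q f) := rfl

theorem tauL2_reflect {q : ℝ → ℝ} (heven : ∀ x, q (-x) = q x) (f : maxDomain q) :
    tauL2 q (reflect heven f) = parity (tauL2 q f) :=
  tauL2_eq_toLp (y := reflect heven f)
    (f.2.2.2.comp_measurePreserving (Measure.measurePreserving_neg volume))
    (Eventually.of_forall fun x => congrFun (tau_comp_neg heven f.2.1) x)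

theorem boundaryFlip_boundaryFlip (p : (Fin 2 → ℂ) × (Fin 2 → ℂ)) :
    boundaryFlip (boundaryFlip p) = p := by
  ext i <;> fin_cases i <;> simp [boundaryFlip]

namespace IsNormalizedPair

variable {q : ℝ → ℝ} {w₁ w₂ : ℝ → ℂ}

theorem deriv_fst_neg (hw : IsNormalizedPair q w₁ w₂) (x : ℝ) :
    deriv w₁ (-x) = deriv w₁ x := by
  have h := congrFun (deriv_comp_neg_eq hw.solution_fst.1.differentiable) x
  rw [funext hw.odd_fst, deriv.fun_neg] at h
  exact (neg_injective h).symm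

theorem deriv_snd_neg (hw : IsNormalizedPair q w₁ w₂) (x : ℝ) :
    deriv w₂ (-x) = -deriv w₂ x := by
  have h := congrFun (deriv_comp_neg_eq hw.solution_snd.1.differentiable) x
  rw [funext hw.even_snd] at h
  rw [h, neg_neg]

/-- Reflection exchanges the ends and changes the sign of derivatives. The oddness of w₁ compensates
that sign in the first bracket; the evenness of w₂ leaves it in the second. -/
theorem hasBoundaryValues_reflect (hw : IsNormalizedPair q w₁ w₂) (heven : ∀ x, q (-x) = q x)
    {f : maxDomain q} {p : (Fin 2 → ℂ) × (Fin 2 → ℂ)} (h : HasBoundaryValues w₁ w₂ f p.1 p.2) :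
    HasBoundaryValues w₁ w₂ (reflect heven f) (boundaryFlip p).1 (boundaryFlip p).2 := by
  have h1 : bracket w₁ (reflect heven f) = fun x => bracket w₁ f (-x) := by
    ext x
    rw [hw.bracket_fst, hw.bracket_fst, reflect, deriv_comp_neg_eq f.2.1.differentiable,
      hw.odd_fst, hw.deriv_fst_neg]
    ring
  have h2 : bracket w₂ (reflect heven f) = fun x => -bracket w₂ f (-x) := by
    ext x
    rw [hw.bracket_snd, hw.bracket_snd, reflect, deriv_comp_neg_eq f.2.1.differentiable,
      hw.even_snd, hw.deriv_snd_neg]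
    ring
  constructor
  · rw [h1]; exact h.beta_one.comp tendsto_neg_atBot_atTop
  · rw [h2]; exact (h.beta_two.comp tendsto_neg_atBot_atTop).neg
  · rw [h1]; exact h.alpha_one.comp tendsto_neg_atTop_atBot
  · rw [h2]; exact (h.alpha_two.comp tendsto_neg_atTop_atBot).neg

theorem hasBoundaryValues_fst (hw : IsNormalizedPair q w₁ w₂) :
    HasBoundaryValues w₁ w₂ w₁ ![0, -1] ![0, -1] := by
  have h1 : bracket w₁ w₁ = fun _ => 0 := by
    ext x; rw [hw.bracket_fst]; ring
  have h2 : bracket w₂ w₁ = fun _ => -1 := by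
    ext x; rw [hw.bracket_snd]; linear_combination -hw.wronskian x
  constructor <;> simp [h1, h2]

theorem hasBoundaryValues_snd (hw : IsNormalizedPair q w₁ w₂) :
    HasBoundaryValues w₁ w₂ w₂ ![1, 0] ![1, 0] := by
  have h1 : bracket w₁ w₂ = fun _ => 1 := by
    ext x; rw [hw.bracket_fst, hw.wronskian]
  have h2 : bracket w₂ w₂ = fun _ => 0 := by
    ext x; rw [hw.bracket_snd]; ring
  constructor <;> simp [h1, h2]

theorem inner_tau_sub_inner_tau (hw : IsNormalizedPair q w₁ w₂) {f g : maxDomain q}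
    {p r : (Fin 2 → ℂ) × (Fin 2 → ℂ)} (hf : HasBoundaryValues w₁ w₂ f p.1 p.2)
    (hg : HasBoundaryValues w₁ w₂ g r.1 r.2) :
    inner ℂ (tauL2 q f) (toL2 q g) - inner ℂ (toL2 q f) (tauL2 q g) = boundaryForm p r := by
  obtain ⟨lt, lb, ht, hb, h⟩ := exists_tendsto_bracket q f g
  have key : ∀ {l : Filter ℝ} {a b c d : ℂ}, Tendsto (bracket w₁ f) l (𝓝 a) →
      Tendsto (bracket w₂ f) l (𝓝 b) → Tendsto (bracket w₁ g) l (𝓝 c) →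
      Tendsto (bracket w₂ g) l (𝓝 d) →
      Tendsto (bracket f g) l (𝓝 (conj a * d - conj b * c)) := by
    intro l a b c d h1 h2 h3 h4
    rw [funext (hw.bracket_eq f g)]
    exact (((Complex.continuous_conj.tendsto a).comp h1).mul h4).sub
      (((Complex.continuous_conj.tendsto b).comp h2).mul h3)
  rw [h, tendsto_nhds_unique ht (key hf.beta_one hf.beta_two hg.beta_one hg.beta_two),
    tendsto_nhds_unique hb (key hf.alpha_one hf.alpha_two hg.alpha_one hg.alpha_two),
    boundaryForm]

theorem exists_tauL2_eq (hw : IsNormalizedPair q w₁ w₂) (h₁ : w₁ ∈ maxDomain q)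
    (h₂ : w₂ ∈ maxDomain q) (g : L2) :
    ∃ y : maxDomain q, tauL2 q y = g ∧ HasBoundaryValues w₁ w₂ y 0
      ![-inner ℂ (toL2 q ⟨w₁, h₁⟩) g, -inner ℂ (toL2 q ⟨w₂, h₂⟩) g] := by
  obtain ⟨y, hy, hb⟩ := hw.exists_tau_eq h₁ h₂ (Lp.memLp g)
  refine ⟨y, ?_, ?_⟩
  · rw [tauL2_eq_toLp (Lp.memLp g) hy, Lp.toLp_coeFn]
  · rw [← inner_toLp h₁.2.1 (Lp.memLp g), ← inner_toLp h₂.2.1 (Lp.memLp g), Lp.toLp_coeFn] at hb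
    exact hb

/-- Parity preserves inner products, fixes w₂ and negates w₁, so this inner product equals its own
negative. -/
theorem inner_fst_snd (hw : IsNormalizedPair q w₁ w₂) (heven : ∀ x, q (-x) = q x)
    (h₁ : w₁ ∈ maxDomain q) (h₂ : w₂ ∈ maxDomain q) :
    inner ℂ (toL2 q ⟨w₁, h₁⟩) (toL2 q ⟨w₂, h₂⟩) = 0 := by
  have e1 : reflect heven ⟨w₁, h₁⟩ = -⟨w₁, h₁⟩ := Subtype.ext (funext hw.odd_fst)
  have e2 : reflect heven ⟨w₂, h₂⟩ = ⟨w₂, h₂⟩ := Subtype.ext (funext hw.even_snd)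
  have h := parity.inner_map_map (toL2 q ⟨w₁, h₁⟩) (toL2 q ⟨w₂, h₂⟩)
  rw [← toL2_reflect heven, ← toL2_reflect heven, e1, e2, map_neg, inner_neg_left] at h
  exact self_eq_neg.1 h.symm

/-- Every element of `ℂ² × ℂ²` is attained as boundary values. -/
theorem exists_hasBoundaryValues (hw : IsNormalizedPair q w₁ w₂) (heven : ∀ x, q (-x) = q x)
    (h₁ : w₁ ∈ maxDomain q) (h₂ : w₂ ∈ maxDomain q) (p : (Fin 2 → ℂ) × (Fin 2 → ℂ)) :
    ∃ f : maxDomain q, HasBoundaryValues w₁ w₂ f p.1 p.2 := by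
  have h12 := hw.inner_fst_snd heven h₁ h₂
  have h21 : inner ℂ (toL2 q ⟨w₂, h₂⟩) (toL2 q ⟨w₁, h₁⟩) = 0 := inner_eq_zero_symm.1 h12
  have hne : ∀ {w : maxDomain q}, w ≠ 0 → inner ℂ (toL2 q w) (toL2 q w) ≠ 0 := fun hw0 => by
    rw [Ne, inner_self_eq_zero, map_eq_zero_iff _ (toL2_injective q)]
    exact hw0
  have hW1 : (⟨w₁, h₁⟩ : maxDomain q) ≠ 0 := fun h => by
    have h0 : w₁ = 0 := congrArg Subtype.val h
    simpa [h0, Pi.zero_def] using hw.wronskian 0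
  have hW2 : (⟨w₂, h₂⟩ : maxDomain q) ≠ 0 := fun h => by
    have h0 : w₂ = 0 := congrArg Subtype.val h
    simpa [h0, Pi.zero_def] using hw.wronskian 0
  have hN1 := hne hW1
  have hN2 := hne hW2
  generalize hN₁ : inner ℂ (toL2 q ⟨w₁, h₁⟩) (toL2 q ⟨w₁, h₁⟩) = N₁ at hN1
  generalize hN₂ : inner ℂ (toL2 q ⟨w₂, h₂⟩) (toL2 q ⟨w₂, h₂⟩) = N₂ at hN2
  -- With w₁ ⊥ w₂, a right-hand side in their span gives `y` the boundary values 0 at -∞ and `p.2 -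
  -- p.1` at +∞. Adding `-p.1 1` times w₁ and `p.1 0` times w₂ then shifts both ends by `p.1`.
  obtain ⟨y, -, hy⟩ := hw.exists_tauL2_eq h₁ h₂
    (((p.1 0 - p.2 0) / N₁) • toL2 q ⟨w₁, h₁⟩ + ((p.1 1 - p.2 1) / N₂) • toL2 q ⟨w₂, h₂⟩)
  simp only [inner_add_right, inner_smul_right, h12, h21, hN₁, hN₂] at hy
  have hd1 := hw.solution_fst.1.differentiable
  have hd2 := hw.solution_snd.1.differentiable
  have hb := (hy.add y.2.1.differentiable (hd1.const_smul (-p.1 1))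
    (hw.hasBoundaryValues_fst.smul (-p.1 1) hd1)).add
    (y.2.1.differentiable.add (hd1.const_smul (-p.1 1))) (hd2.const_smul (p.1 0))
    (hw.hasBoundaryValues_snd.smul (p.1 0) hd2)
  refine ⟨y + (-p.1 1) • ⟨w₁, h₁⟩ + p.1 0 • ⟨w₂, h₂⟩, ?_⟩
  convert hb using 1
  · rfl
  · ext i
    fin_cases i <;> simp
  · ext i
    fin_cases i
    · simp [div_mul_cancel₀ _ hN1]
    · simp [div_mul_cancel₀ _ hN2]

end IsNormalizedPair

/-! ### Adjoints of the extensions -/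

theorem mem_boundaryDomain_iff {q : ℝ → ℝ} {w₁ w₂ : ℝ → ℂ}
    {S : Submodule ℂ ((Fin 2 → ℂ) × (Fin 2 → ℂ))}
    {f : maxDomain q} {p : (Fin 2 → ℂ) × (Fin 2 → ℂ)} (hf : HasBoundaryValues w₁ w₂ f p.1 p.2) :
    f ∈ boundaryDomain q w₁ w₂ S ↔ p ∈ S := by
  constructor
  · rintro ⟨r, hr, hfr⟩
    obtain ⟨e1, e2⟩ := hf.unique hfr
    rwa [Prod.ext e1 e2]
  · exact fun hp => ⟨p, hp, hf⟩

theorem mem_graph_extensionOf {q : ℝ → ℝ} {w₁ w₂ : ℝ → ℂ}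
    {S : Submodule ℂ ((Fin 2 → ℂ) × (Fin 2 → ℂ))} {x : L2 × L2} :
    x ∈ (extensionOf q w₁ w₂ S).graph ↔
      ∃ f ∈ boundaryDomain q w₁ w₂ S, toL2 q f = x.1 ∧ tauL2 q f = x.2 := by
  rw [LinearPMap.mem_graph_iff]
  constructor
  · rintro ⟨⟨_, f, hf, rfl⟩, h1, h2⟩
    exact ⟨f, hf, h1, (restrictedOperator_apply q _ f hf).symm.trans h2⟩
  · rintro ⟨f, hf, h1, h2⟩
    exact ⟨⟨toL2 q f, Submodule.mem_map_of_mem hf⟩, h1,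
      (restrictedOperator_apply q _ f hf).trans h2⟩

namespace IsNormalizedPair

variable {q : ℝ → ℝ} {w₁ w₂ : ℝ → ℂ}

/-- The adjoint of the minimal operator is contained in the maximal operator. -/
theorem exists_of_forall_inner_eq (hw : IsNormalizedPair q w₁ w₂) (h₁ : w₁ ∈ maxDomain q)
    (h₂ : w₂ ∈ maxDomain q) {h k : L2}
    (hk : ∀ f : maxDomain q, HasBoundaryValues w₁ w₂ f 0 0 →
      inner ℂ h (tauL2 q f) = inner ℂ k (toL2 q f)) :
    ∃ v : maxDomain q, toL2 q v = h ∧ tauL2 q v = k := by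
  obtain ⟨u, hu, hub⟩ := hw.exists_tauL2_eq h₁ h₂ k
  set W : Submodule ℂ L2 := Submodule.span ℂ {toL2 q ⟨w₁, h₁⟩, toL2 q ⟨w₂, h₂⟩} with hW
  have : FiniteDimensional ℂ W := FiniteDimensional.span_of_finite ℂ (Set.toFinite _)
  -- Any g orthogonal to w₁ and w₂ is τy for some y with zero boundary values at both ends, so the
  -- hypothesis and Green's formula make h - u orthogonal to g. As W is finite-dimensional, h - u
  -- lies in W, the span of two solutions of τw = 0.
  have hmem : h - toL2 q u ∈ Wᗮᗮ := by
    rw [Submodule.mem_orthogonal']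
    intro g hg
    have hg1 : inner ℂ (toL2 q ⟨w₁, h₁⟩) g = 0 :=
      (Submodule.mem_orthogonal _ _).1 hg _ (Submodule.subset_span (by simp))
    have hg2 : inner ℂ (toL2 q ⟨w₂, h₂⟩) g = 0 :=
      (Submodule.mem_orthogonal _ _).1 hg _ (Submodule.subset_span (by simp))
    obtain ⟨y, hy, hyb⟩ := hw.exists_tauL2_eq h₁ h₂ g
    rw [hg1, hg2, neg_zero] at hyb
    have hyb0 : HasBoundaryValues w₁ w₂ y 0 0 := by
      convert hyb using 1
      ext i
      fin_cases i <;> rfl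
    have hG := hw.inner_tau_sub_inner_tau (p := (0, _)) (r := (0, 0)) hub hyb0
    have e := hk y hyb0
    rw [hu, hy] at hG
    rw [hy] at e
    rw [inner_sub_left, e]
    simpa [boundaryForm] using hG
  rw [Submodule.orthogonal_orthogonal, hW, Submodule.mem_span_pair] at hmem
  obtain ⟨c, d, hcd⟩ := hmem
  refine ⟨u + (c • ⟨w₁, h₁⟩ + d • ⟨w₂, h₂⟩), ?_, ?_⟩
  · rw [map_add, map_add, map_smul, map_smul, hcd]
    abel
  · rw [map_add, map_add, map_smul, map_smul, tauL2_eq_zero (y := ⟨w₁, h₁⟩) hw.solution_fst,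
      tauL2_eq_zero (y := ⟨w₂, h₂⟩) hw.solution_snd, hu]
    simp

/-- If k is orthogonal to the domain, the pair (0, k) satisfies the adjoint relation of the minimal
operator. So k = τv with v = 0 in L², and k vanishes. -/
theorem dense_domain (hw : IsNormalizedPair q w₁ w₂) (h₁ : w₁ ∈ maxDomain q)
    (h₂ : w₂ ∈ maxDomain q) (S : Submodule ℂ ((Fin 2 → ℂ) × (Fin 2 → ℂ))) :
    Dense ((extensionOf q w₁ w₂ S).domain : Set L2) := by
  rw [Submodule.dense_iff_topologicalClosure_eq_top, Submodule.topologicalClosure_eq_top_iff,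
    Submodule.eq_bot_iff]
  intro k hk
  obtain ⟨v, hv, hvk⟩ := hw.exists_of_forall_inner_eq h₁ h₂ (h := 0) (k := k) fun f hf => by
    rw [inner_zero_left]
    exact ((Submodule.mem_orthogonal' _ _).1 hk _
      (Submodule.mem_map_of_mem ⟨0, S.zero_mem, hf⟩)).symm
  rw [map_eq_zero_iff _ (toL2_injective q)] at hv
  rw [← hvk, hv, map_zero]

theorem mem_graph_adjoint (hw : IsNormalizedPair q w₁ w₂) (heven : ∀ x, q (-x) = q x)
    (h₁ : w₁ ∈ maxDomain q) (h₂ : w₂ ∈ maxDomain q)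
    (S : Submodule ℂ ((Fin 2 → ℂ) × (Fin 2 → ℂ))) {x : L2 × L2} :
    x ∈ (extensionOf q w₁ w₂ S).adjoint.graph ↔
      ∃ v : maxDomain q, (∃ r : (Fin 2 → ℂ) × (Fin 2 → ℂ), (∀ s ∈ S, boundaryForm s r = 0) ∧
        HasBoundaryValues w₁ w₂ v r.1 r.2) ∧ toL2 q v = x.1 ∧ tauL2 q v = x.2 := by
  rw [LinearPMap.adjoint_graph_eq_graph_adjoint (hw.dense_domain h₁ h₂ S),
    Submodule.mem_adjoint_iff]
  have hgraph : (∀ a b, (a, b) ∈ (extensionOf q w₁ w₂ S).graph →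
      inner ℂ b x.1 - inner ℂ a x.2 = 0) ↔ ∀ f ∈ boundaryDomain q w₁ w₂ S,
      inner ℂ (tauL2 q f) x.1 - inner ℂ (toL2 q f) x.2 = 0 := by
    constructor
    · exact fun h f hf => h _ _ (mem_graph_extensionOf.2 ⟨f, hf, rfl, rfl⟩)
    · intro h a b hab
      obtain ⟨f, hf, rfl, rfl⟩ := mem_graph_extensionOf.1 hab
      exact h f hf
  rw [hgraph]
  constructor
  · intro h
    obtain ⟨v, hv1, hv2⟩ := hw.exists_of_forall_inner_eq h₁ h₂ (h := x.1) (k := x.2)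
      fun f hf => by
        have e := sub_eq_zero.1 (h f ⟨0, S.zero_mem, hf⟩)
        rw [← inner_conj_symm, e, inner_conj_symm]
    obtain ⟨r, hr⟩ := exists_boundaryValues h₁ h₂ v
    refine ⟨v, ⟨r, fun s hs => ?_, hr⟩, hv1, hv2⟩
    obtain ⟨f, hf⟩ := hw.exists_hasBoundaryValues heven h₁ h₂ s
    rw [← hw.inner_tau_sub_inner_tau hf hr, hv1, hv2]
    exact h f ⟨s, hs, hf⟩
  · rintro ⟨v, ⟨r, hr, hrv⟩, hv1, hv2⟩ f ⟨s, hs, hf⟩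
    rw [← hv1, ← hv2, hw.inner_tau_sub_inner_tau hf hrv, hr s hs]

/-- The extension given by `S` is `P`-self-adjoint if and only if `S` coincides with the
reflection of its annihilator with respect to the boundary form. -/
theorem isPSelfAdjoint_extensionOf_iff (hw : IsNormalizedPair q w₁ w₂)
    (heven : ∀ x, q (-x) = q x) (h₁ : w₁ ∈ maxDomain q) (h₂ : w₂ ∈ maxDomain q)
    (S : Submodule ℂ ((Fin 2 → ℂ) × (Fin 2 → ℂ))) :
    IsPSelfAdjoint (extensionOf q w₁ w₂ S) ↔
      ∀ r, r ∈ S ↔ ∀ s ∈ S, boundaryForm s (boundaryFlip r) = 0 := by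
  set H := extensionOf q w₁ w₂ S with hH
  constructor
  · rintro ⟨-, -, hdom, -⟩ r
    obtain ⟨f, hf⟩ := hw.exists_hasBoundaryValues heven h₁ h₂ r
    have hleft : r ∈ S ↔ toL2 q f ∈ H.domain := by
      rw [← mem_boundaryDomain_iff hf]
      exact ((toL2_injective q).mem_set_image (s := (boundaryDomain q w₁ w₂ S : Set _))).symm
    rw [hleft, hdom, LinearPMap.mem_domain_iff]
    have hrf := hw.hasBoundaryValues_reflect heven hf
    constructor
    · rintro ⟨y, hy⟩
      obtain ⟨v, ⟨r', hr', hv⟩, hv1, -⟩ := (hw.mem_graph_adjoint heven h₁ h₂ S).1 hy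
      have e : v = reflect heven f := toL2_injective q hv1
      rw [e] at hv
      obtain ⟨e1, e2⟩ := hrf.unique hv
      rwa [Prod.ext e1 e2]
    · intro h
      exact ⟨_, (hw.mem_graph_adjoint heven h₁ h₂ S).2
        ⟨reflect heven f, ⟨_, h, hrf⟩, rfl, rfl⟩⟩
  · intro hS
    have hdense := hw.dense_domain h₁ h₂ S
    -- Closedness, equality of domains and equality of values are all read off from this
    -- correspondence of graphs.
    have key : ∀ x y : L2, (x, y) ∈ H.graph ↔ (parity x, parity y) ∈ H.adjoint.graph := by
      intro x y
      rw [mem_graph_extensionOf, hw.mem_graph_adjoint heven h₁ h₂ S]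
      constructor
      · rintro ⟨f, ⟨r, hr, hf⟩, rfl, rfl⟩
        exact ⟨reflect heven f, ⟨_, (hS r).1 hr, hw.hasBoundaryValues_reflect heven hf⟩,
          rfl, tauL2_reflect heven f⟩
      · rintro ⟨v, ⟨r, hr, hv⟩, hv1, hv2⟩
        refine ⟨reflect heven v, ⟨boundaryFlip r, (hS _).2 ?_,
          hw.hasBoundaryValues_reflect heven hv⟩, ?_, ?_⟩
        · rwa [boundaryFlip_boundaryFlip]
        · rw [toL2_reflect, hv1, parity_parity]
        · rw [tauL2_reflect, hv2, parity_parity]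
    refine ⟨hdense, ?_, fun f => ?_, fun f g hgf => ?_⟩
    · have hcl : (H.graph : Set (L2 × L2)) =
          (fun x : L2 × L2 => (parity x.1, parity x.2)) ⁻¹' H.adjoint.graph := by
        ext ⟨x, y⟩
        exact key x y
      rw [LinearPMap.IsClosed, hcl]
      exact (LinearPMap.adjoint_isClosed hdense).preimage
        ((parity.continuous.comp continuous_fst).prodMk (parity.continuous.comp continuous_snd))
    · rw [LinearPMap.mem_domain_iff, LinearPMap.mem_domain_iff]
      constructor
      · rintro ⟨y, hy⟩
        exact ⟨_, (key _ _).1 hy⟩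
      · rintro ⟨y, hy⟩
        refine ⟨parity y, (key _ _).2 ?_⟩
        rwa [parity_parity]
    · have h1 := (key _ _).1 (H.mem_graph f)
      have h2 := H.adjoint.mem_graph g
      rw [hgf] at h2
      have h3 := H.adjoint.mem_graph_snd_inj h1 h2 rfl
      rw [← h3, parity_parity]

end IsNormalizedPair

/-! ### Boundary conditions that are invariant under reflection -/

theorem boundaryForm_flip (s r : (Fin 2 → ℂ) × (Fin 2 → ℂ)) :
    boundaryForm s (boundaryFlip r) =
      conj (s.1 0) * r.2 1 + conj (s.1 1) * r.2 0 - conj (s.2 0) * r.1 1 - conj (s.2 1) * r.1 0 := by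
  simp [boundaryForm, boundaryFlip]
  ring

theorem mem_mixedConditionLeft {a b c d : ℂ} {p : (Fin 2 → ℂ) × (Fin 2 → ℂ)} :
    p ∈ mixedConditionLeft !![a, b; c, d] ↔
      p.1 0 = a * p.2 0 + b * p.2 1 ∧ p.1 1 = c * p.2 0 + d * p.2 1 := by
  change p.1 = _ ↔ _
  simp [funext_iff, Fin.forall_fin_two, dotProduct]

theorem mem_separatedCondition {ξ η : ℂ} {α β : ℝ} {p : (Fin 2 → ℂ) × (Fin 2 → ℂ)} :
    p ∈ separatedCondition ξ η α β ↔
      p.1 0 * ξ * (Real.cos α : ℂ) - p.1 1 * (Real.sin α : ℂ) = 0 ∧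
        p.2 0 * η * (Real.cos β : ℂ) - p.2 1 * (Real.sin β : ℂ) = 0 := Iff.rfl

theorem mixedConditionLeft_invariant_iff (a b c d : ℂ) :
    (∀ r, r ∈ mixedConditionLeft !![a, b; c, d] ↔
      ∀ s ∈ mixedConditionLeft !![a, b; c, d], boundaryForm s (boundaryFlip r) = 0) ↔
      d = conj a ∧ b.im = 0 ∧ c.im = 0 := by
  simp only [mem_mixedConditionLeft, boundaryForm_flip]
  constructor
  · intro h
    -- Here (x, y) and (z, t) are the values of `r` and `s` at +∞; unit vectors extract the entries
    -- of M*J - JM.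
    have key := fun x y z t : ℂ =>
      (h (![a * x + b * y, c * x + d * y], ![x, y])).1 ⟨rfl, rfl⟩
        (![a * z + b * t, c * z + d * t], ![z, t]) ⟨rfl, rfl⟩
    have k1 := key 1 0 1 0
    have k2 := key 1 0 0 1
    have k4 := key 0 1 0 1
    simp at k1 k2 k4
    refine ⟨?_, Complex.conj_eq_iff_im.1 (sub_eq_zero.1 k4),
      Complex.conj_eq_iff_im.1 (sub_eq_zero.1 k1)⟩
    rw [← sub_eq_zero.1 k2, Complex.conj_conj]
  · rintro ⟨rfl, hb, hc⟩ r
    rw [← Complex.conj_eq_iff_im] at hb hc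
    constructor
    · rintro ⟨h1, h2⟩ s ⟨h3, h4⟩
      simp only [h1, h2, h3, h4, map_add, map_mul, Complex.conj_conj, hb, hc]
      ring
    · intro h
      have k1 := h (![a, c], ![1, 0]) (by simp)
      have k2 := h (![b, conj a], ![0, 1]) (by simp)
      simp [hb, hc] at k1 k2
      constructor
      · linear_combination -k2
      · linear_combination -k1

/-- Exchanging the two ends turns this condition into the left one and only negates the flipped
form. -/
theorem mixedConditionRight_invariant_iff (a b c d : ℂ) :
    (∀ r, r ∈ mixedConditionRight !![a, b; c, d] ↔
      ∀ s ∈ mixedConditionRight !![a, b; c, d], boundaryForm s (boundaryFlip r) = 0) ↔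
      d = conj a ∧ b.im = 0 ∧ c.im = 0 := by
  rw [← mixedConditionLeft_invariant_iff]
  have hswap : ∀ p : (Fin 2 → ℂ) × (Fin 2 → ℂ), p.swap ∈ mixedConditionRight !![a, b; c, d] ↔
      p ∈ mixedConditionLeft !![a, b; c, d] := fun p => Iff.rfl
  have hform : ∀ s r : (Fin 2 → ℂ) × (Fin 2 → ℂ), boundaryForm s.swap (boundaryFlip r.swap) =
      -boundaryForm s (boundaryFlip r) := fun s r => by
    rw [boundaryForm_flip, boundaryForm_flip, Prod.fst_swap, Prod.snd_swap, Prod.fst_swap,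
      Prod.snd_swap]
    ring
  refine (Equiv.prodComm _ _).forall_congr fun {r} => ?_
  refine iff_congr (hswap r.swap) ((Equiv.prodComm _ _).forall_congr fun {s} => ?_)
  refine imp_congr (hswap s.swap) ?_
  have h := hform s r
  rw [Equiv.prodComm_apply, Equiv.prodComm_apply, h, neg_eq_zero]

/-! ### Separated conditions as a scalar equation -/

theorem linear_form_eq_zero_of_det_eq_zero {A B C D x y : ℂ} (hne : A ≠ 0 ∨ B ≠ 0)
    (hdet : A * D = B * C) (h : A * x + B * y = 0) : C * x + D * y = 0 := by
  rcases hne with hA | hB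
  · refine (mul_eq_zero.1 (?_ : A * (C * x + D * y) = 0)).resolve_left hA
    linear_combination C * h + y * hdet
  · refine (mul_eq_zero.1 (?_ : B * (C * x + D * y) = 0)).resolve_left hB
    linear_combination D * h - x * hdet

theorem conj_mul_self_of_norm_eq_one {ξ : ℂ} (h : ‖ξ‖ = 1) : conj ξ * ξ = 1 := by
  rw [Complex.conj_mul', h]
  simp

theorem cos_ne_zero_or_sin_ne_zero (α : ℝ) :
    (Real.cos α : ℂ) ≠ 0 ∨ (Real.sin α : ℂ) ≠ 0 := by
  by_contra! h
  have h1 := Real.sin_sq_add_cos_sq α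
  rw [Complex.ofReal_eq_zero.1 h.1, Complex.ofReal_eq_zero.1 h.2] at h1
  norm_num at h1

/-- The conditions describe a product of lines spanned by (sin α, ξ cos α) and (sin β, η cos β). The
equation says that the flipped form vanishes on these generators, up to the factor ξ. Both subspaces
then coincide, since a nonzero functional on ℂ² has a kernel of dimension one. -/
theorem separatedCondition_invariant_iff {ξ η : ℂ} (hξ : ‖ξ‖ = 1) (hη : ‖η‖ = 1) (α β : ℝ) :
    (∀ r, r ∈ separatedCondition ξ η α β ↔
      ∀ s ∈ separatedCondition ξ η α β, boundaryForm s (boundaryFlip r) = 0) ↔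
      ξ * η * ((Real.sin α * Real.cos β : ℝ) : ℂ) + ((Real.cos α * Real.sin β : ℝ) : ℂ) = 0 := by
  simp only [mem_separatedCondition, boundaryForm_flip, Complex.ofReal_mul]
  have hξ' := conj_mul_self_of_norm_eq_one hξ
  have hη' := conj_mul_self_of_norm_eq_one hη
  have hξ0 : ξ ≠ 0 := norm_ne_zero_iff.1 (by simp [hξ])
  have hη0 : η ≠ 0 := norm_ne_zero_iff.1 (by simp [hη])
  have hα := cos_ne_zero_or_sin_ne_zero α
  have hβ := cos_ne_zero_or_sin_ne_zero β
  have hcα := Complex.conj_ofReal (Real.cos α)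
  have hsα := Complex.conj_ofReal (Real.sin α)
  have hcβ := Complex.conj_ofReal (Real.cos β)
  have hsβ := Complex.conj_ofReal (Real.sin β)
  generalize (Real.cos α : ℂ) = ca at *
  generalize (Real.sin α : ℂ) = sa at *
  generalize (Real.cos β : ℂ) = cb at *
  generalize (Real.sin β : ℂ) = sb at *
  constructor
  · intro h
    have k := (h (0, ![sb, η * cb])).1 ⟨by simp, by simp; ring⟩ (![sa, ξ * ca], 0)
      ⟨by simp; ring, by simp⟩
    simp [hcα, hsα] at k
    linear_combination ξ * k - ca * sb * hξ'
  · intro hC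
    have hC' := congrArg conj hC
    simp only [map_add, map_mul, map_zero, hcα, hsα, hcβ, hsβ] at hC'
    -- `hd1` and its conjugate `hd2` are the vanishing determinants that make the relevant linear
    -- forms proportional.
    have hd1 : conj ξ * ca * sb + sa * (η * cb) = 0 := by
      linear_combination conj ξ * hC - η * sa * cb * hξ'
    have hd2 : conj η * cb * sa + sb * (ξ * ca) = 0 := by
      linear_combination ξ * hC' - conj η * sa * cb * hξ'
    refine fun r => ⟨fun ⟨h1, h2⟩ s ⟨h3, h4⟩ => ?_, fun h => ⟨?_, ?_⟩⟩
    · have h3' := congrArg conj h3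
      have h4' := congrArg conj h4
      simp only [map_sub, map_mul, map_zero, hcα, hsα, hcβ, hsβ] at h3' h4'
      have e3 := linear_form_eq_zero_of_det_eq_zero (A := conj ξ * ca) (B := -sa) (C := η * cb)
        (D := sb) (x := conj (s.1 0)) (y := conj (s.1 1)) (by simpa [hξ0] using hα)
        (by linear_combination hd1) (by linear_combination h3')
      have e4 := linear_form_eq_zero_of_det_eq_zero (A := conj η * cb) (B := -sb) (C := ξ * ca)
        (D := sa) (x := conj (s.2 0)) (y := conj (s.2 1)) (by simpa [hη0] using hβ)
        (by linear_combination hd2) (by linear_combination h4')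
      have e1 := linear_form_eq_zero_of_det_eq_zero (A := η * cb) (B := -sb) (C := conj (s.1 1))
        (D := conj (s.1 0)) (x := r.2 0) (y := r.2 1) (by simpa [hη0] using hβ)
        (by linear_combination e3) (by linear_combination h2)
      have e2 := linear_form_eq_zero_of_det_eq_zero (A := ξ * ca) (B := -sa) (C := conj (s.2 1))
        (D := conj (s.2 0)) (x := r.1 0) (y := r.1 1) (by simpa [hξ0] using hα)
        (by linear_combination e4) (by linear_combination h1)
      linear_combination e1 - e2
    -- Testing against the generator at +∞ yields a linear equation for `r.1` proportional to the
    -- condition at -∞; the next case is its mirror image.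
    · have k := h (0, ![sb, η * cb]) ⟨by simp, by simp; ring⟩
      simp [hcβ, hsβ] at k
      have := linear_form_eq_zero_of_det_eq_zero (A := conj η * cb) (B := sb) (C := ξ * ca)
        (D := -sa) (x := r.1 0) (y := r.1 1) (by simpa [hη0] using hβ)
        (by linear_combination -hd2) (by linear_combination -k)
      linear_combination this
    · have k := h (![sa, ξ * ca], 0) ⟨by simp; ring, by simp⟩
      simp [hcα, hsα] at k
      have := linear_form_eq_zero_of_det_eq_zero (A := conj ξ * ca) (B := sa) (C := η * cb)
        (D := -sb) (x := r.2 0) (y := r.2 1) (by simpa [hξ0] using hα)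
        (by linear_combination -hd1) (by linear_combination k)
      linear_combination this

/-! ### From the scalar equation to congruences modulo π -/

theorem modEq_zero_pi_iff (x : ℝ) : x ≡ 0 [PMOD Real.pi] ↔ Real.sin x = 0 := by
  rw [AddCommGroup.modEq_comm, AddCommGroup.modEq_iff_zsmul, Real.sin_eq_zero_iff]
  simp

theorem abs_modEq_zero_pi_iff (x : ℝ) : |x| ≡ 0 [PMOD Real.pi] ↔ Real.sin x = 0 := by
  rw [modEq_zero_pi_iff]
  rcases abs_choice x with h | h <;> simp [h]

theorem mem_quarter_turns_iff {α : ℝ} (hα : α ∈ Set.Ico (0 : ℝ) (2 * Real.pi)) :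
    α ∈ ({0, Real.pi / 2, Real.pi, 3 * Real.pi / 2} : Set ℝ) ↔
      Real.sin α = 0 ∨ Real.cos α = 0 := by
  have hpi := Real.pi_pos
  constructor
  · rintro (rfl | rfl | rfl | rfl)
    · simp
    · simp
    · simp
    · right
      rw [show 3 * Real.pi / 2 = Real.pi / 2 + Real.pi by ring, Real.cos_add_pi]
      simp
  · rintro (h | h)
    · obtain ⟨n, hn⟩ := Real.sin_eq_zero_iff.1 h
      have h1 : (-1 : ℝ) < n := by nlinarith [hα.1]
      have h2 : (n : ℝ) < 2 := by nlinarith [hα.2]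
      have h1' : -1 < n := by exact_mod_cast h1
      have h2' : n < 2 := by exact_mod_cast h2
      interval_cases n <;> simp [← hn]
    · obtain ⟨n, hn⟩ := Real.cos_eq_zero_iff.1 h
      have h1 : (-1 : ℝ) < n := by nlinarith [hα.1]
      have h2 : (n : ℝ) < 2 := by nlinarith [hα.2]
      have h1' : -1 < n := by exact_mod_cast h1
      have h2' : n < 2 := by exact_mod_cast h2
      interval_cases n
      · simp [hn]
      · right; right; right
        rw [Set.mem_singleton_iff, hn]
        norm_num

theorem unimodular_combination_eq_zero_iff_of_mul_eq_zero {ζ : ℂ} (hζ : ζ ≠ 0) {x y : ℝ}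
    (hxy : x * y = 0) : ζ * (x : ℂ) + (y : ℂ) = 0 ↔ x + y = 0 := by
  rcases mul_eq_zero.1 hxy with rfl | rfl <;> simp [hζ]

/-- Taking norms forces |x| = |y|, and then the sign relating x and y determines ζ = ±1. -/
theorem unimodular_combination_eq_zero_iff {ζ : ℂ} (hζ : ‖ζ‖ = 1) {x y : ℝ} (hx : x ≠ 0) :
    ζ * (x : ℂ) + (y : ℂ) = 0 ↔ (x + y = 0 ∧ ζ = 1) ∨ (x - y = 0 ∧ ζ = -1) := by
  have hx' : (x : ℂ) ≠ 0 := Complex.ofReal_ne_zero.2 hx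
  constructor
  · intro h
    have h1 : |x| = |y| := by
      have h2 := congrArg norm (eq_neg_of_add_eq_zero_left h)
      simpa [hζ] using h2
    rcases abs_eq_abs.1 h1 with rfl | rfl
    · refine Or.inr ⟨sub_self _, mul_right_cancel₀ hx' ?_⟩
      linear_combination h
    · refine Or.inl ⟨by ring, mul_right_cancel₀ hx' ?_⟩
      push_cast at h ⊢
      linear_combination h
  · rintro (⟨h, rfl⟩ | ⟨h, rfl⟩)
    · rw [one_mul]
      exact_mod_cast h
    · obtain rfl := sub_eq_zero.1 h
      ring

end PTSL

end

theorem mainTheorem6 (q : ℝ → ℝ) (hq : MeasureTheory.LocallyIntegrable q MeasureTheory.volume)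
    (heven : ∀ x, q (-x) = q x)
    (htop : PTSL.LimitCircleAtTop q) (hbot : PTSL.LimitCircleAtBot q)
    (w₁ w₂ : ℝ → ℂ) (hw : PTSL.IsNormalizedPair q w₁ w₂) :
    (∀ ξ η : ℂ, ‖ξ‖ = 1 → ‖η‖ = 1 →
      ∀ α ∈ Set.Ico (0 : ℝ) (2 * Real.pi), ∀ β ∈ Set.Ico (0 : ℝ) (2 * Real.pi),
        ((α ∈ ({0, Real.pi / 2, Real.pi, 3 * Real.pi / 2} : Set ℝ) ∨
            β ∈ ({0, Real.pi / 2, Real.pi, 3 * Real.pi / 2} : Set ℝ)) →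
          (PTSL.IsPSelfAdjoint
              (PTSL.extensionOf q w₁ w₂ (PTSL.separatedCondition ξ η α β)) ↔
            α + β ≡ 0 [PMOD Real.pi])) ∧
        ((α ∉ ({0, Real.pi / 2, Real.pi, 3 * Real.pi / 2} : Set ℝ) ∧
            β ∉ ({0, Real.pi / 2, Real.pi, 3 * Real.pi / 2} : Set ℝ)) →
          (PTSL.IsPSelfAdjoint
              (PTSL.extensionOf q w₁ w₂ (PTSL.separatedCondition ξ η α β)) ↔
            (α + β ≡ 0 [PMOD Real.pi] ∧ ξ * η = 1) ∨
            (|α - β| ≡ 0 [PMOD Real.pi] ∧ ξ * η = -1)))) ∧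
    (∀ a b c d : ℂ,
      (PTSL.IsPSelfAdjoint
          (PTSL.extensionOf q w₁ w₂ (PTSL.mixedConditionLeft !![a, b; c, d])) ↔
        d = (starRingEnd ℂ) a ∧ b.im = 0 ∧ c.im = 0) ∧
      (PTSL.IsPSelfAdjoint
          (PTSL.extensionOf q w₁ w₂ (PTSL.mixedConditionRight !![a, b; c, d])) ↔
        d = (starRingEnd ℂ) a ∧ b.im = 0 ∧ c.im = 0)) := by
  have h₁ := hw.solution_fst.mem_maxDomain htop hbot
  have h₂ := hw.solution_snd.mem_maxDomain htop hbot
  have key := hw.isPSelfAdjoint_extensionOf_iff heven h₁ h₂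
  refine ⟨fun ξ η hξ hη α hα β hβ => ?_, fun a b c d =>
    ⟨(key _).trans (PTSL.mixedConditionLeft_invariant_iff a b c d),
      (key _).trans (PTSL.mixedConditionRight_invariant_iff a b c d)⟩⟩
  have hζ : ‖ξ * η‖ = 1 := by rw [norm_mul, hξ, hη, one_mul]
  have hζ0 : ξ * η ≠ 0 := norm_ne_zero_iff.1 (by rw [hζ]; exact one_ne_zero)
  -- With x = sin α cos β and y = cos α sin β, the congruences become x + y = 0 and x - y = 0, and
  -- the criterion is ξηx + y = 0. A quarter turn at either end means xy = 0.
  rw [key, PTSL.separatedCondition_invariant_iff hξ hη, PTSL.modEq_zero_pi_iff,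
    PTSL.abs_modEq_zero_pi_iff, PTSL.mem_quarter_turns_iff hα, PTSL.mem_quarter_turns_iff hβ,
    Real.sin_add, Real.sin_sub]
  constructor
  · intro h
    refine PTSL.unimodular_combination_eq_zero_iff_of_mul_eq_zero hζ0 ?_
    rcases h with (h | h) | (h | h) <;> rw [h] <;> ring
  · rintro ⟨h, h'⟩
    push Not at h h'
    exact PTSL.unimodular_combination_eq_zero_iff hζ (mul_ne_zero h.1 h'.2)
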